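/- **Setting.** Let $K\ge 1$, $I=[0,1]^K$, $\ell$ Lebesgue measure, $a\in(0,1)$. Let $(\theta_i,\boldsymbol\xi_i)$, $i=1,2,\dots$, be i.i.d. with $\theta_i\sim\mathrm{Bernoulli}(a)$; given $\theta_i=0$ (the null $H_i$ is true) $\boldsymbol\xi_i$ is uniform on $I$, and given $\theta_i=1$ ($H_i$ is false) $\boldsymbol\xi_i\sim G$, where $G$ has a density $g\in C(I)$ with $g(\mathbf x)<g(\mathbf 0)<\infty$ for all $\mathbf x\in I\setminus\{\mathbf 0\}$. Suppose that for some $\varepsilon>0$ and $\gamma_1,\dots,\gamma_K>0$, $$g(\mathbf x)=g(\mathbf 0)\Big(1-\sum_k\gamma_k x_k^{\varepsilon}+r(\mathbf x)\Big),\quad \mathbf x\in I,\qquad r(\mathbf x)=o(|\mathbf x|^{\varepsilon})\ \text{as } \mathbf x\to\mathbf 0,$$ and that $h(u):=\ell(\Gamma_u)$ is continuous in $u\in[0,\infty)$, where $\Gamma_u=\{\mathbf x\in I:g(\mathbf x)\ge u\}$. Let $\alpha_*=1/(1-a+a\sup g)$, where $\sup$ is the essential supremum (so $\sup g = g(\mathbf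 0)$). **Procedures.** Given $\alpha\in(0,1)$ and $n$ nulls: * The *optimal procedure*: with $h^*(t)=\inf\{u\ge0:h(u)\le t\}$ and $D_t=\Gamma_{h^*(t)}$, reject $H_i$ if and only if $\boldsymbol\xi_i\in D_\tau$, where $\tau=\sup\{t\in[0,1]:t/\alpha\le (R(t)\vee1)/n\}$ and $R(t)=\#\{i\le n:\boldsymbol\xi_i\in D_t\}$. * The *approximate procedure*: with $h(u;\boldsymbol\gamma)=\ell(\{\mathbf x\in I:\sum_k\gamma_kx_k^\varepsilon\le u\})$ and $s_i=h(\sum_k\gamma_k\xi_{ik}^\varepsilon;\boldsymbol\gamma)$, apply the Benjamini–Hochberg procedure to $s_1,\dots,s_n$, i.e. reject $H_i$ if and only if $s_i\le\sup\{t\in[0,1]:t/\alpha\le(\#\{j\le n:s_j\le t\}\vee1)/n\}$. The power of a procedure is $E\big[(R-V)/((n-N)\vee1)\big]$, with $R$ the number of rejected nulls, $V$ that of rejected true nulls, and $N$ that of true nulls. Let $\mathcal V_o,\mathcal D_o$ (respectively $\mathcal V,\mathcal D$) be the sets of true nulls and of false nulls that are rejected by the optimal (respectively approximate) procedure. **Proposition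 4.2.** For $\alpha\in(\alpha_*,1)$ the power of the optimal procedure has a limit $\mathrm{Pow}_o(\alpha)$ as $n\to\infty$. For all $\alpha>\alpha_*$ sufficiently close to $\alpha_*$, the power of the approximate procedure has a limit $\mathrm{Pow}(\alpha)$ as $n\to\infty$, and $|\mathcal D_o\triangle\mathcal D|/|\mathcal D_o\cap\mathcal D|$ and $|\mathcal V_o\triangle\mathcal V|/|\mathcal V_o\cap\mathcal V|$ converge in probability, as $n\to\infty$, to constants $r_D(\alpha)$ and $r_V(\alpha)$. Moreover, as $\alpha\downarrow\alpha_*$, $$\frac{\mathrm{Pow}_o(\alpha)}{\mathrm{Pow}(\alpha)}\to1,\qquad r_D(\alpha)\to0,\qquad r_V(\alpha)\to0 .$$ -/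

import Mathlib

open MeasureTheory ProbabilityTheory Filter Topology Asymptotics

noncomputable section

namespace MultiFDR

/-- The unit cube `[0,1]^K`, the range of a `K`-dimensional multivariate p-value. -/
def cube (K : ℕ) : Set (Fin K → ℝ) := Set.Icc 0 1

/-! ### The random effects model -/

/-- The distribution `G` of the p-values under false nulls: the measure on `[0,1]^K` that has
density `g` with respect to Lebesgue measure. -/
def altLaw {K : ℕ} (g : (Fin K → ℝ) → ℝ) : Measure (Fin K → ℝ) :=
  (volume.restrict (cube K)).withDensity (fun x => ENNReal.ofReal (g x))

/-- The joint law of `(θ_i, ξ_i)`: with probability `1 - a` the null is true (`θ_i = false`) and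
`ξ_i` is uniform on `[0,1]^K` (i.e. has i.i.d. uniform coordinates); with probability `a` the null
is false (`θ_i = true`) and `ξ_i ∼ G`. -/
def pairLaw {K : ℕ} (a : ℝ) (g : (Fin K → ℝ) → ℝ) : Measure (Bool × (Fin K → ℝ)) :=
  ENNReal.ofReal (1 - a) • (Measure.dirac false).prod (volume.restrict (cube K)) +
    ENNReal.ofReal a • (Measure.dirac true).prod (altLaw g)

/-- `(θ_i, ξ_i)`, `i = 0, 1, 2, …`, are i.i.d. with law `pairLaw a g`. Here `θ i ω = true` means
that the `i`-th null is false. -/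
structure RandomEffectsModel {Ω : Type*} [MeasurableSpace Ω] (P : Measure Ω) {K : ℕ} (a : ℝ)
    (g : (Fin K → ℝ) → ℝ) (θ : ℕ → Ω → Bool) (ξ : ℕ → Ω → Fin K → ℝ) : Prop where
  measurable_θ : ∀ i, Measurable (θ i)
  measurable_ξ : ∀ i, Measurable (ξ i)
  indep : iIndepFun (fun i ω => (θ i ω, ξ i ω)) P
  law : ∀ i, P.map (fun ω => (θ i ω, ξ i ω)) = pairLaw a g

/-- `α_* = 1 / (1 - a + a sup g)`, where `sup` is the essential supremum over `[0,1]^K` with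
respect to Lebesgue measure. -/
def alphaStar {K : ℕ} (a : ℝ) (g : (Fin K → ℝ) → ℝ) : ℝ :=
  1 / (1 - a + a * essSup g (volume.restrict (cube K)))

/-! ### The testing procedure based on a nested family of regions -/

open Classical in
/-- `R(t) = #{i < n : x_i ∈ D_t}`. -/
def count {X : Type*} (D : ℝ → Set X) (n : ℕ) (x : ℕ → X) (t : ℝ) : ℕ :=
  ((Finset.range n).filter (fun i => x i ∈ D t)).card

/-- `τ = sup {t ∈ [0,1] : t / α ≤ (R(t) ∨ 1) / n}`. -/
def threshold {X : Type*} (D : ℝ → Set X) (α : ℝ) (n : ℕ) (x : ℕ → X) : ℝ :=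
  sSup {t : ℝ | t ∈ Set.Icc (0 : ℝ) 1 ∧ t / α ≤ (max (count D n x t) 1 : ℕ) / (n : ℝ)}

open Classical in
/-- The procedure based on the family `D`, applied to the first `n` nulls: reject the `i`-th null
if and only if `x_i ∈ D_τ`. The value is the set of (indices of) rejected nulls. -/
def rejected {X : Type*} (D : ℝ → Set X) (α : ℝ) (n : ℕ) (x : ℕ → X) : Finset ℕ :=
  (Finset.range n).filter (fun i => x i ∈ D (threshold D α n x))

/-- The Benjamini-Hochberg procedure applied to the real numbers `s_i`, `i < n`: reject the `i`-th
null if and only if `s_i ≤ τ`, where `τ = sup {t ∈ [0,1] : t / α ≤ (#{i : s_i ≤ t} ∨ 1) / n}`. -/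
def bhRejected (α : ℝ) (n : ℕ) (s : ℕ → ℝ) : Finset ℕ :=
  rejected (fun t => Set.Iic t) α n s

/-! ### The procedure based on the superlevel sets of the density -/

/-- `Γ_u = {x ∈ [0,1]^K : g x ≥ u}`. -/
def superlevel {K : ℕ} (g : (Fin K → ℝ) → ℝ) (u : ℝ) : Set (Fin K → ℝ) :=
  {x | x ∈ cube K ∧ u ≤ g x}

/-- `h(u) = ℓ(Γ_u)`. -/
def superlevelVol {K : ℕ} (g : (Fin K → ℝ) → ℝ) (u : ℝ) : ℝ :=
  volume.real (superlevel g u)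

/-- `h^*(t) = inf {u ≥ 0 : h(u) ≤ t}`. -/
def superlevelInv {K : ℕ} (g : (Fin K → ℝ) → ℝ) (t : ℝ) : ℝ :=
  sInf {u : ℝ | 0 ≤ u ∧ superlevelVol g u ≤ t}

/-- The nulls rejected by the procedure based on `D_t = Γ_{h^*(t)}`. -/
def optRejected {K : ℕ} (g : (Fin K → ℝ) → ℝ) (α : ℝ) (n : ℕ) (x : ℕ → Fin K → ℝ) : Finset ℕ :=
  rejected (fun t => superlevel g (superlevelInv g t)) α n x

/-! ### The procedure based on weighted `L^ε` balls -/

/-- `ν' x^ε = ∑ ν_k x_k ^ ε`. -/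
def weightedSum {K : ℕ} (ε : ℝ) (ν x : Fin K → ℝ) : ℝ := ∑ k, ν k * x k ^ ε

/-- `h(u; ν) = ℓ({x ∈ [0,1]^K : ν' x^ε ≤ u})`. -/
def ballVol {K : ℕ} (ε : ℝ) (ν : Fin K → ℝ) (u : ℝ) : ℝ :=
  volume.real {x : Fin K → ℝ | x ∈ cube K ∧ weightedSum ε ν x ≤ u}

/-- The nulls rejected by the Benjamini-Hochberg procedure applied to `s_i = h(ν' x_i^ε; ν)`. -/
def ballRejected {K : ℕ} (ε : ℝ) (ν : Fin K → ℝ) (α : ℝ) (n : ℕ) (x : ℕ → Fin K → ℝ) :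
    Finset ℕ :=
  bhRejected α n (fun i => ballVol ε ν (weightedSum ε ν (x i)))

/-! ### Power and relative differences -/

/-- The true nulls among the first `n`. -/
def trueNulls (n : ℕ) (θ : ℕ → Bool) : Finset ℕ := (Finset.range n).filter (fun i => θ i = false)

/-- The false nulls among the first `n`. -/
def falseNulls (n : ℕ) (θ : ℕ → Bool) : Finset ℕ := (Finset.range n).filter (fun i => θ i = true)

/-- The power `E[(R - V) / ((n - N) ∨ 1)]` for `n` nulls of the procedure `rej`, which maps the
p-values to the set of rejected nulls. `R - V` is the number of rejected false nulls and `n - N`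
that of false nulls. -/
def power {Ω : Type*} [MeasurableSpace Ω] (P : Measure Ω) {K : ℕ} (θ : ℕ → Ω → Bool)
    (ξ : ℕ → Ω → Fin K → ℝ) (rej : ℕ → (ℕ → Fin K → ℝ) → Finset ℕ) (n : ℕ) : ℝ :=
  ∫ ω, ((rej n (fun i => ξ i ω) ∩ falseNulls n (fun i => θ i ω)).card : ℝ) /
    (max (falseNulls n (fun i => θ i ω)).card 1 : ℕ) ∂P

/-- `|A ∆ B| / |A ∩ B|`. -/
def relDiff (A B : Finset ℕ) : ℝ := ((symmDiff A B).card : ℝ) / ((A ∩ B).card : ℝ)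

end MultiFDR

end

open MultiFDR

/-! Both procedures are Benjamini–Hochberg procedures for a score `S` that is uniform under true
nulls: `levelScore` is h(g(x)), and `ballScore` is h(γ'x^ε; γ). For such a score the empirical
distribution function tends almost surely to (1 - a) t + a Φ(t), where Φ = `mass g S`. If this limit
crosses the line t / α exactly once, from above, at t₀, then the random threshold tends to t₀. The
rejected nulls then have the same limiting frequencies as the fixed region {S ≤ t₀}
(`RandomEffectsModel.ae_tendsto_card_inter`), and the power tends to Φ(t₀).

Division by t turns the crossing equation into Φ(t) / t = q, with q = `crossLevel a α` independent
of the score. So at their limiting thresholds both procedures have the same mean density q, and q ↑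
g(0) as α ↓ α_*. For superlevel sets the mean density decreases strictly on all of (0, 1], which
gives a crossing for every α in (α_*, 1). For balls it decreases near 0 because the mean of w =
γ'x^ε over a small ball of radius u is c u with c < 1. Away from 0 it stays below a constant less
than g(0), so a unique crossing exists once α is close to α_*.

It remains to compare the two regions. Near the origin the relative deficit 1 - g / g(0) lies
between (1 - δ) w and (1 + δ) w, so a superlevel set lies between balls of radii η / (1 + δ) and η /
(1 - δ). The mean deficit is then nearly c η on the superlevel set and nearly c u on the ball, and
their equality forces u ≈ η (`IsPeaked.exists_ball_subset_superlevel_subset_ball`). Since small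
balls have volume proportional to u^(K/ε), the symmetric difference is negligible relative to the
intersection (`IsPeaked.exists_volume_symmDiff_le`). This is the claim for true nulls. The bounds
g(0)/2 ≤ g ≤ g(0) transfer it to false nulls, and the power ratio is q s / (q t) = s / t for the two
crossings s and t. -/

namespace MultiFDR

/-! ### Empirical frequencies -/

/-- The proportion of `x_0, …, x_{n-1}` that lie in `C`. -/
noncomputable def freq {β : Type*} (C : Set β) (x : ℕ → β) (n : ℕ) : ℝ :=
  (∑ i ∈ Finset.range n, C.indicator (fun _ => (1 : ℝ)) (x i)) / n

open Classical in
lemma freq_eq_card {β : Type*} (C : Set β) (x : ℕ → β) (n : ℕ) :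
    freq C x n = (((Finset.range n).filter (fun i => x i ∈ C)).card : ℝ) / n := by
  simp [freq, Set.indicator_apply, Finset.sum_boole]

lemma freq_mono {β : Type*} {C C' : Set β} (h : C ⊆ C') (x : ℕ → β) (n : ℕ) :
    freq C x n ≤ freq C' x n := by
  unfold freq
  gcongr with i _

lemma ae_tendsto_freq {Ω β : Type*} [MeasurableSpace Ω] [MeasurableSpace β] {P : Measure Ω}
    [IsProbabilityMeasure P] {μ : Measure β} {X : ℕ → Ω → β} (hm : ∀ i, Measurable (X i))
    (hind : iIndepFun X P) (hl : ∀ i, P.map (X i) = μ) {C : Set β} (hC : MeasurableSet C) :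
    ∀ᵐ ω ∂P, Tendsto (freq C (fun i => X i ω)) atTop (𝓝 (μ.real C)) := by
  have hf : Measurable (C.indicator (fun _ => (1 : ℝ))) := measurable_const.indicator hC
  have h := strong_law_ae_real (μ := P) (fun i => C.indicator (fun _ => (1 : ℝ)) ∘ X i) ?_ ?_ ?_
  · have e : ∫ ω, (C.indicator (fun _ => (1 : ℝ)) ∘ X 0) ω ∂P = μ.real C := by
      rw [← hl 0]
      simp only [Function.comp_apply]
      rw [← integral_map (hm 0).aemeasurable hf.aestronglyMeasurable, integral_indicator hC]
      simp
    rw [e] at h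
    exact h
  · refine Integrable.of_bound (hf.comp (hm 0)).aestronglyMeasurable 1 (ae_of_all _ fun ω => ?_)
    by_cases h : X 0 ω ∈ C <;> simp [h]
  · exact fun i j hij => (hind.comp _ (fun _ => hf)).indepFun hij
  · exact fun i => IdentDistrib.comp ⟨(hm i).aemeasurable, (hm 0).aemeasurable, by simp [hl]⟩ hf

/-! ### The Benjamini-Hochberg threshold -/

lemma count_mono {n : ℕ} {s : ℕ → ℝ} {t t' : ℝ} (h : t ≤ t') :
    count (fun t => Set.Iic t) n s t ≤ count (fun t => Set.Iic t) n s t' :=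
  Finset.card_le_card <| Finset.monotone_filter_right _ fun i _ hi =>
    (show s i ≤ t from hi).trans h

lemma count_div (n : ℕ) (s : ℕ → ℝ) (t : ℝ) :
    (count (fun t => Set.Iic t) n s t : ℝ) / n = freq (Set.Iic t) s n := by
  rw [freq_eq_card]; rfl

lemma le_threshold {α : ℝ} {n : ℕ} {s : ℕ → ℝ} {t : ℝ} (ht : t ∈ Set.Icc (0 : ℝ) 1)
    (h : t / α ≤ (max (count (fun t => Set.Iic t) n s t) 1 : ℕ) / (n : ℝ)) :
    t ≤ threshold (fun t => Set.Iic t) α n s :=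
  le_csSup ⟨1, fun _ hx => hx.1.2⟩ ⟨ht, h⟩

/-- The supremum is attained: an admissible t satisfies t ≤ α (R(t) ∨ 1) / n ≤ α (R(τ) ∨ 1) / n
because R is nondecreasing, and the left side passes to its supremum. -/
lemma threshold_mem {α : ℝ} (hα : 0 < α) (n : ℕ) (s : ℕ → ℝ) :
    threshold (fun t => Set.Iic t) α n s ∈ Set.Icc (0 : ℝ) 1 ∧
      threshold (fun t => Set.Iic t) α n s / α ≤
        (max (count (fun t => Set.Iic t) n s (threshold (fun t => Set.Iic t) α n s)) 1 : ℕ) /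
          (n : ℝ) := by
  have h0 : (0 : ℝ) ≤ threshold (fun t => Set.Iic t) α n s :=
    le_threshold ⟨le_rfl, zero_le_one⟩ (by rw [zero_div]; positivity)
  have hne : {t : ℝ | t ∈ Set.Icc (0 : ℝ) 1 ∧
      t / α ≤ (max (count (fun t => Set.Iic t) n s t) 1 : ℕ) / (n : ℝ)}.Nonempty :=
    ⟨0, ⟨le_rfl, zero_le_one⟩, by rw [zero_div]; positivity⟩
  refine ⟨⟨h0, csSup_le hne fun t ht => ht.1.2⟩, ?_⟩
  rw [div_le_iff₀ hα]
  refine csSup_le hne fun t ht => ?_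
  have h1 := le_threshold ht.1 ht.2
  have h2 := ht.2
  rw [div_le_iff₀ hα] at h2
  refine h2.trans ?_
  gcongr
  exact count_mono h1

/-- A deterministic statement that needs convergence only at rational points, so that countably many
almost sure events suffice. Monotonicity of the frequencies and continuity of F do the rest. -/
lemma tendsto_threshold {s : ℕ → ℝ} {F : ℝ → ℝ} {α t₀ : ℝ} (hα : 0 < α)
    (hF : ∀ q : ℚ, (q : ℝ) ∈ Set.Icc (0 : ℝ) 1 →
      Tendsto (freq (Set.Iic (q : ℝ)) s) atTop (𝓝 (F q)))
    (hFc : ContinuousOn F (Set.Icc 0 1)) (ht₀ : t₀ ∈ Set.Ioo (0 : ℝ) 1)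
    (hlow : ∀ t ∈ Set.Ioo 0 t₀, t / α < F t) (hup : ∀ t ∈ Set.Ioc t₀ 1, F t < t / α) :
    Tendsto (fun n => threshold (fun t => Set.Iic t) α n s) atTop (𝓝 t₀) := by
  refine tendsto_order.2 ⟨fun b hb => ?_, fun b hb => ?_⟩
  · obtain ⟨q, hq1, hq2⟩ := exists_rat_btwn (max_lt hb ht₀.1)
    rw [max_lt_iff] at hq1
    have hq : (q : ℝ) ∈ Set.Icc (0 : ℝ) 1 := ⟨hq1.2.le, (hq2.trans ht₀.2).le⟩
    filter_upwards [(tendsto_order.1 (hF q hq)).1 _ (hlow q ⟨hq1.2, hq2⟩)] with n hn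
    refine hq1.1.trans_le (le_threshold hq (hn.le.trans ?_))
    rw [← count_div]
    gcongr
    exact le_max_left _ _
  -- Compactness reduces the claim to excluding the threshold from a neighbourhood of each L in `[b,
  -- 1]`. There the frequency at one rational point bounds all the others.
  · have key : ∀ᶠ n in atTop, threshold (fun t => Set.Iic t) α n s ∉ Set.Icc b 1 := by
      refine (isCompact_Icc (a := b) (b := (1 : ℝ))).induction_on
        (p := fun A => ∀ᶠ n in atTop, threshold (fun t => Set.Iic t) α n s ∉ A) (by simp)
        (fun A B hAB hB => hB.mono fun n hn h => hn (hAB h))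
        (fun A B hA hB => by filter_upwards [hA, hB] with n h1 h2 h using h.elim h1 h2) ?_
      intro L hL
      have hL0 : 0 < L := ht₀.1.trans (hb.trans_le hL.1)
      -- Positivity of c lets it dominate the term 1 / n that comes from R ∨ 1.
      obtain ⟨c, hc1, hc2⟩ := exists_between
        (max_lt (hup L ⟨hb.trans_le hL.1, hL.2⟩) (div_pos hL0 hα))
      rw [max_lt_iff] at hc1
      have hev : ∀ᶠ q in 𝓝[Set.Icc 0 1] L, F q < c :=
        (hFc L ⟨hL0.le, hL.2⟩).eventually_lt_const hc1.1
      obtain ⟨q, hq, hqc, hqn⟩ : ∃ q : ℚ, (q : ℝ) ∈ Set.Icc (0 : ℝ) 1 ∧ F q < c ∧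
          Set.Iic (q : ℝ) ∈ 𝓝[Set.Icc b 1] L := by
        -- The rational point must bound a neighbourhood of L from above yet stay in `[0, 1]`; at L
        -- = 1 the point 1 itself serves.
        rcases hL.2.lt_or_eq with h1 | h1
        · have h2 : ∀ᶠ q in 𝓝[>] L, F q < c := by
            rw [eventually_nhdsWithin_iff] at hev ⊢
            filter_upwards [hev, eventually_lt_nhds h1] with x hx hx1 hx2
            exact hx ⟨hL0.le.trans (le_of_lt hx2), hx1.le⟩
          obtain ⟨u, hu, hu2⟩ := (mem_nhdsGT_iff_exists_Ioo_subset).1 h2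
          obtain ⟨q, hq1, hq2⟩ := exists_rat_btwn (lt_min h1 hu)
          rw [lt_min_iff] at hq2
          exact ⟨q, ⟨(hL0.trans hq1).le, hq2.1.le⟩, hu2 ⟨hq1, hq2.2⟩,
            mem_nhdsWithin_of_mem_nhds (Iic_mem_nhds hq1)⟩
        · refine ⟨1, by simp, ?_, ?_⟩
          · subst h1
            simpa using hc1.1
          · filter_upwards [self_mem_nhdsWithin] with x hx
            simpa using hx.2
      refine ⟨Set.Iic (q : ℝ) ∩ {x | c < x / α}, inter_mem hqn (mem_nhdsWithin_of_mem_nhds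
        ((continuous_id.div_const α).tendsto L |>.eventually_const_lt hc2)), ?_⟩
      filter_upwards [(hF q hq).eventually_lt_const hqc,
        (tendsto_one_div_atTop_nhds_zero_nat (𝕜 := ℝ)).eventually_lt_const hc1.2] with n h1 h2 h3
      have h4 := (h3.2 : c < _).trans_le (threshold_mem hα n s).2
      refine lt_irrefl _ (h4.trans_le ?_)
      rw [Nat.cast_max, Nat.cast_one, ← max_div_div_right (Nat.cast_nonneg n), count_div]
      exact max_le ((freq_mono (Set.Iic_subset_Iic.2 h3.1) _ _).trans h1.le) h2.le
    filter_upwards [key] with n hn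
    by_contra h
    exact hn ⟨not_lt.1 h, (threshold_mem hα n s).1.2⟩

lemma mem_bhRejected {α : ℝ} {n i : ℕ} {s : ℕ → ℝ} :
    i ∈ bhRejected α n s ↔ i < n ∧ s i ≤ threshold (fun t => Set.Iic t) α n s := by
  simp [bhRejected, rejected]

/-- Serves measurability: the supremum over uncountably many t becomes a finite union over the
possible counts k, each with candidate threshold α (k ∨ 1) / n capped at 1. The count at τ witnesses
the forward direction. -/
lemma mem_bhRejected_iff_exists {α : ℝ} (hα : 0 < α) {n i : ℕ} {s : ℕ → ℝ} :
    i ∈ bhRejected α n s ↔ i < n ∧ ∃ k ∈ Finset.range (n + 1),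
      k ≤ count (fun t => Set.Iic t) n s (min 1 ((max k 1 : ℕ) / (n : ℝ) * α)) ∧
        s i ≤ min 1 ((max k 1 : ℕ) / (n : ℝ) * α) := by
  rw [mem_bhRejected]
  refine and_congr_right fun hi => ⟨fun h => ?_, ?_⟩
  · obtain ⟨h1, h2⟩ := threshold_mem hα n s
    rw [div_le_iff₀ hα] at h2
    refine ⟨_, ?_, count_mono (le_min h1.2 h2), h.trans (le_min h1.2 h2)⟩
    exact Finset.mem_range_succ_iff.2 ((Finset.card_filter_le _ _).trans (by simp))
  · rintro ⟨k, -, hk, hs⟩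
    refine hs.trans (le_threshold ⟨le_min zero_le_one (by positivity), min_le_left _ _⟩ ?_)
    rw [div_le_iff₀ hα]
    refine (min_le_right _ _).trans ?_
    gcongr

lemma measurable_count {Ω : Type*} [MeasurableSpace Ω] {s : ℕ → Ω → ℝ}
    (hs : ∀ i, Measurable (s i)) (n : ℕ) (t : ℝ) :
    Measurable fun ω => count (fun t => Set.Iic t) n (fun i => s i ω) t := by
  classical
  have : (fun ω => count (fun t => Set.Iic t) n (fun i => s i ω) t) =
      fun ω => ∑ i ∈ Finset.range n, (s i ⁻¹' Set.Iic t).indicator (fun _ => 1) ω := by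
    ext ω
    simp [count, Set.indicator_apply, Finset.sum_boole]
  rw [this]
  exact Finset.measurable_sum _ fun i _ => measurable_const.indicator (hs i measurableSet_Iic)

lemma measurableSet_mem_bhRejected {Ω : Type*} [MeasurableSpace Ω] {s : ℕ → Ω → ℝ}
    (hs : ∀ i, Measurable (s i)) {α : ℝ} (hα : 0 < α) (n i : ℕ) :
    MeasurableSet {ω | i ∈ bhRejected α n (fun i => s i ω)} := by
  have : {ω | i ∈ bhRejected α n (fun i => s i ω)} = {_ω : Ω | i < n} ∩
      ⋃ k ∈ Finset.range (n + 1), {ω | k ≤ count (fun t => Set.Iic t) n (fun i => s i ω)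
        (min 1 ((max k 1 : ℕ) / (n : ℝ) * α))} ∩
          {ω | s i ω ≤ min 1 ((max k 1 : ℕ) / (n : ℝ) * α)} := by
    ext ω
    simp only [Set.mem_ofPred_eq, mem_bhRejected_iff_exists hα, Set.mem_inter_iff, Set.mem_iUnion,
      exists_prop]
  rw [this]
  refine (MeasurableSet.const _).inter (Finset.measurableSet_biUnion _ fun k _ => ?_)
  exact (measurableSet_le measurable_const (measurable_count hs n _)).inter
    (measurableSet_le (hs i) measurable_const)

/-! ### Frequencies at convergent thresholds -/

/-- The moving thresholds are sandwiched between rational ones near the limit. Monotonicity of the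
sets and continuity of H close the gap. -/
lemma tendsto_freq_of_tendsto {β : Type*} {x : ℕ → β} {S T : β → ℝ} {C : Set β}
    {H : ℝ → ℝ → ℝ} {σ τ : ℕ → ℝ} {s₀ t₀ : ℝ} (hσ : Tendsto σ atTop (𝓝 s₀))
    (hτ : Tendsto τ atTop (𝓝 t₀))
    (hH : ∀ q r : ℚ, Tendsto (freq {z | z ∈ C ∧ S z ≤ q ∧ T z ≤ r} x) atTop (𝓝 (H q r)))
    (hc : ContinuousAt (fun p : ℝ × ℝ => H p.1 p.2) (s₀, t₀)) :
    Tendsto (fun n => freq {z | z ∈ C ∧ S z ≤ σ n ∧ T z ≤ τ n} x n) atTop (𝓝 (H s₀ t₀)) := by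
  refine tendsto_order.2 ⟨fun b hb => ?_, fun b hb => ?_⟩
  · obtain ⟨δ, hδ, h⟩ := Metric.eventually_nhds_iff.1 (hc.eventually_const_lt hb)
    obtain ⟨q, hq1, hq2⟩ := exists_rat_btwn (sub_lt_self s₀ hδ)
    obtain ⟨r, hr1, hr2⟩ := exists_rat_btwn (sub_lt_self t₀ hδ)
    have hb' : b < H q r := h (y := (q, r)) <| by
      rw [Prod.dist_eq, max_lt_iff, Real.dist_eq, Real.dist_eq, abs_lt, abs_lt]
      exact ⟨⟨by linarith, by linarith⟩, by linarith, by linarith⟩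
    filter_upwards [(hH q r).eventually_const_lt hb', hσ.eventually_const_lt hq2,
      hτ.eventually_const_lt hr2] with n h1 h2 h3
    have hsub : {z | z ∈ C ∧ S z ≤ q ∧ T z ≤ r} ⊆ {z | z ∈ C ∧ S z ≤ σ n ∧ T z ≤ τ n} :=
      fun z hz => ⟨hz.1, hz.2.1.trans h2.le, hz.2.2.trans h3.le⟩
    exact h1.trans_le (freq_mono hsub _ _)
  · obtain ⟨δ, hδ, h⟩ := Metric.eventually_nhds_iff.1 (hc.eventually_lt_const hb)
    obtain ⟨q, hq1, hq2⟩ := exists_rat_btwn (lt_add_of_pos_right s₀ hδ)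
    obtain ⟨r, hr1, hr2⟩ := exists_rat_btwn (lt_add_of_pos_right t₀ hδ)
    have hb' : H q r < b := h (y := (q, r)) <| by
      rw [Prod.dist_eq, max_lt_iff, Real.dist_eq, Real.dist_eq, abs_lt, abs_lt]
      exact ⟨⟨by linarith, by linarith⟩, by linarith, by linarith⟩
    filter_upwards [(hH q r).eventually_lt_const hb', hσ.eventually_lt_const hq1,
      hτ.eventually_lt_const hr1] with n h1 h2 h3
    have hsub : {z | z ∈ C ∧ S z ≤ σ n ∧ T z ≤ τ n} ⊆ {z | z ∈ C ∧ S z ≤ q ∧ T z ≤ r} :=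
      fun z hz => ⟨hz.1, hz.2.1.trans h2.le, hz.2.2.trans h3.le⟩
    exact (freq_mono hsub _ _).trans_lt h1

lemma abs_measureReal_inter_sub_le {β : Type*} [MeasurableSpace β] (μ : Measure β)
    [IsFiniteMeasure μ] {A A' B : Set β} (hA : MeasurableSet A) (hA' : MeasurableSet A')
    (hB : MeasurableSet B) (h : A ⊆ A' ∨ A' ⊆ A) :
    |μ.real (A ∩ B) - μ.real (A' ∩ B)| ≤ |μ.real A - μ.real A'| := by
  have key : ∀ {A A' : Set β}, MeasurableSet A → MeasurableSet A' → A ⊆ A' →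
      |μ.real (A ∩ B) - μ.real (A' ∩ B)| ≤ |μ.real A - μ.real A'| := by
    intro A A' hA hA' h
    rw [abs_sub_comm, abs_sub_comm (μ.real A), abs_of_nonneg (sub_nonneg.2 (measureReal_mono h)),
      abs_of_nonneg (sub_nonneg.2 (measureReal_mono (Set.inter_subset_inter_left _ h))),
      ← measureReal_sdiff h hA, ← measureReal_sdiff (Set.inter_subset_inter_left _ h) (hA.inter hB)]
    refine measureReal_mono fun z hz => ⟨hz.1.1, fun hzA => hz.2 ⟨hzA, hz.1.2⟩⟩
  rcases h with h | h
  · exact key hA hA' h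
  · rw [abs_sub_comm, abs_sub_comm (μ.real A)]
    exact key hA' hA h

/-- Moving one threshold at a time, each move costs at most the increment of the corresponding
marginal distribution function. -/
lemma continuousAt_measureReal_inter {β : Type*} [MeasurableSpace β] (μ : Measure β)
    [IsFiniteMeasure μ] {S T : β → ℝ} {C : Set β} (hS : Measurable S) (hT : Measurable T)
    (hC : MeasurableSet C) {s₀ t₀ : ℝ} (hSc : ContinuousAt (fun t => μ.real {z | S z ≤ t}) s₀)
    (hTc : ContinuousAt (fun t => μ.real {z | T z ≤ t}) t₀) :
    ContinuousAt (fun p : ℝ × ℝ => μ.real {z | z ∈ C ∧ S z ≤ p.1 ∧ T z ≤ p.2}) (s₀, t₀) := by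
  have hSm : ∀ t, MeasurableSet {z | S z ≤ t} := fun t => hS measurableSet_Iic
  have hTm : ∀ t, MeasurableSet {z | T z ≤ t} := fun t => hT measurableSet_Iic
  have hS' : Tendsto (fun p : ℝ × ℝ => |μ.real {z | S z ≤ p.1} - μ.real {z | S z ≤ s₀}|)
      (𝓝 (s₀, t₀)) (𝓝 0) := by
    have := ((hSc.tendsto.comp (continuous_fst.tendsto (s₀, t₀))).sub_const
      (μ.real {z | S z ≤ s₀})).abs
    simpa using this
  have hT' : Tendsto (fun p : ℝ × ℝ => |μ.real {z | T z ≤ p.2} - μ.real {z | T z ≤ t₀}|)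
      (𝓝 (s₀, t₀)) (𝓝 0) := by
    have := ((hTc.tendsto.comp (continuous_snd.tendsto (s₀, t₀))).sub_const
      (μ.real {z | T z ≤ t₀})).abs
    simpa using this
  have hsum := hS'.add hT'
  rw [add_zero] at hsum
  refine tendsto_iff_norm_sub_tendsto_zero.2 (squeeze_zero (fun _ => norm_nonneg _)
    (fun p => ?_) hsum)
  have h1 := abs_measureReal_inter_sub_le μ (hSm p.1) (hSm s₀) (hC.inter (hTm p.2))
    ((le_total p.1 s₀).imp (fun h z hz => le_trans hz h) (fun h z hz => le_trans hz h))
  have h2 := abs_measureReal_inter_sub_le μ (hTm p.2) (hTm t₀) (hC.inter (hSm s₀))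
    ((le_total p.2 t₀).imp (fun h z hz => le_trans hz h) (fun h z hz => le_trans hz h))
  have e1 : ∀ s t, {z | z ∈ C ∧ S z ≤ s ∧ T z ≤ t} = {z | S z ≤ s} ∩ (C ∩ {z | T z ≤ t}) := by
    intro s t; ext z; simp only [Set.mem_ofPred_eq, Set.mem_inter_iff]; tauto
  have e2 : ∀ s t, {z | z ∈ C ∧ S z ≤ s ∧ T z ≤ t} = {z | T z ≤ t} ∩ (C ∩ {z | S z ≤ s}) := by
    intro s t; ext z; simp only [Set.mem_ofPred_eq, Set.mem_inter_iff]; tauto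
  rw [← e1, ← e1] at h1
  rw [← e2, ← e2] at h2
  rw [Real.norm_eq_abs]
  refine (abs_sub_le _ _ _).trans (add_le_add h1 h2)

/-! ### The model and its uniform scores -/

lemma measurableSet_cube (K : ℕ) : MeasurableSet (cube K) := measurableSet_Icc

lemma isCompact_cube (K : ℕ) : IsCompact (cube K) := isCompact_Icc

lemma volume_cube (K : ℕ) : volume (cube K) = 1 := by
  rw [cube, Real.volume_Icc_pi]
  simp

lemma volume_ne_top_of_subset_cube {K : ℕ} {A : Set (Fin K → ℝ)} (h : A ⊆ cube K) :
    volume A ≠ ⊤ :=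
  measure_ne_top_of_subset h (by simp [volume_cube])

/-- The part of the cube where the score `S` is at most `t`. -/
def region {K : ℕ} (S : (Fin K → ℝ) → ℝ) (t : ℝ) : Set (Fin K → ℝ) :=
  {x | x ∈ cube K ∧ S x ≤ t}

/-- The mass that the density `g` gives to `region S t`. -/
noncomputable def mass {K : ℕ} (g S : (Fin K → ℝ) → ℝ) (t : ℝ) : ℝ :=
  ∫ x in region S t, g x

/-- A score that is uniformly distributed under true nulls. -/
structure UniformScore {K : ℕ} (S : (Fin K → ℝ) → ℝ) : Prop where
  measurable : Measurable S
  volume_region : ∀ t ∈ Set.Icc (0 : ℝ) 1, volume.real (region S t) = t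

/-- The distribution function `(1 - a) t + a Φ t` crosses the line `t / α` from above at `t₀`, and
only there. -/
structure IsCrossing (a α : ℝ) (Φ : ℝ → ℝ) (t₀ : ℝ) : Prop where
  mem : t₀ ∈ Set.Ioo (0 : ℝ) 1
  below : ∀ t ∈ Set.Ioo 0 t₀, t / α < (1 - a) * t + a * Φ t
  eq : t₀ / α = (1 - a) * t₀ + a * Φ t₀
  above : ∀ t ∈ Set.Ioc t₀ 1, (1 - a) * t + a * Φ t < t / α

section Model

variable {K : ℕ} {g S T : (Fin K → ℝ) → ℝ}

lemma region_subset_cube (S : (Fin K → ℝ) → ℝ) (t : ℝ) : region S t ⊆ cube K := fun _ h => h.1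

lemma region_mono (S : (Fin K → ℝ) → ℝ) {s t : ℝ} (h : s ≤ t) : region S s ⊆ region S t :=
  fun _ hx => ⟨hx.1, hx.2.trans h⟩

lemma UniformScore.measurableSet_region (hS : UniformScore S) (t : ℝ) :
    MeasurableSet (region S t) :=
  (measurableSet_cube K).inter (hS.measurable measurableSet_Iic)

lemma integrableOn_of_subset_cube (hg : ContinuousOn g (cube K)) {A : Set (Fin K → ℝ)}
    (hA : A ⊆ cube K) : IntegrableOn g A :=
  (hg.integrableOn_compact (isCompact_cube K)).mono_set hA

lemma UniformScore.volume_shell (hS : UniformScore S) {s t : ℝ} (hs : 0 ≤ s) (hst : s ≤ t)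
    (ht : t ≤ 1) : volume.real (region S t \ region S s) = t - s := by
  rw [measureReal_sdiff (region_mono S hst) (hS.measurableSet_region s)
    (volume_ne_top_of_subset_cube (region_subset_cube S t)),
    hS.volume_region t ⟨hs.trans hst, ht⟩, hS.volume_region s ⟨hs, hst.trans ht⟩]

lemma UniformScore.mass_sub (hS : UniformScore S) (hg : ContinuousOn g (cube K)) {s t : ℝ}
    (hst : s ≤ t) : mass g S t - mass g S s = ∫ x in region S t \ region S s, g x := by
  rw [setIntegral_sdiff (hS.measurableSet_region s)
    (integrableOn_of_subset_cube hg (region_subset_cube S t)) (region_mono S hst)]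
  rfl

lemma setIntegral_le_mul_volume {f : (Fin K → ℝ) → ℝ} {A : Set (Fin K → ℝ)}
    (hf : IntegrableOn f A) (hA : MeasurableSet A) (hAc : A ⊆ cube K) {c : ℝ}
    (h : ∀ x ∈ A, f x ≤ c) : ∫ x in A, f x ≤ c * volume.real A := by
  have h1 := setIntegral_mono_on hf (integrableOn_const (volume_ne_top_of_subset_cube hAc)) hA h
  rwa [setIntegral_const, smul_eq_mul, mul_comm] at h1

lemma mul_volume_le_setIntegral {f : (Fin K → ℝ) → ℝ} {A : Set (Fin K → ℝ)}
    (hf : IntegrableOn f A) (hA : MeasurableSet A) (hAc : A ⊆ cube K) {c : ℝ}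
    (h : ∀ x ∈ A, c ≤ f x) : c * volume.real A ≤ ∫ x in A, f x := by
  have h1 := setIntegral_mono_on (integrableOn_const (volume_ne_top_of_subset_cube hAc)) hf hA h
  rwa [setIntegral_const, smul_eq_mul, mul_comm] at h1

/-- Lipschitz, with a bound of |g| as constant, because the shell between levels s and t has volume
t - s. -/
lemma UniformScore.continuousOn_mass (hS : UniformScore S) (hg : ContinuousOn g (cube K)) :
    ContinuousOn (mass g S) (Set.Icc 0 1) := by
  obtain ⟨C, hC⟩ := (isCompact_cube K).exists_bound_of_continuousOn hg
  have key : ∀ s ∈ Set.Icc (0 : ℝ) 1, ∀ t ∈ Set.Icc (0 : ℝ) 1, s ≤ t →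
      |mass g S t - mass g S s| ≤ C * (t - s) := by
    intro s hs t ht hst
    have hsub : region S t \ region S s ⊆ cube K := fun x hx => hx.1.1
    rw [hS.mass_sub hg hst, ← hS.volume_shell hs.1 hst ht.2]
    exact norm_setIntegral_le_of_norm_le_const
      (lt_top_iff_ne_top.2 (volume_ne_top_of_subset_cube hsub)) (fun x hx => hC x (hsub hx))
  have hL : LipschitzOnWith C.toNNReal (mass g S) (Set.Icc 0 1) := by
    refine LipschitzOnWith.of_dist_le_mul fun s hs t ht => ?_
    have hC' : C ≤ C.toNNReal := Real.le_coe_toNNReal C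
    rw [Real.dist_eq, Real.dist_eq]
    rcases le_total s t with h | h
    · rw [abs_sub_comm, abs_sub_comm s, abs_of_nonneg (sub_nonneg.2 h)]
      exact (key s hs t ht h).trans (mul_le_mul_of_nonneg_right hC' (sub_nonneg.2 h))
    · rw [abs_of_nonneg (sub_nonneg.2 h)]
      exact (key t ht s hs h).trans (mul_le_mul_of_nonneg_right hC' (sub_nonneg.2 h))
  exact hL.continuousOn

/-- The mass of `A ⊆ [0,1]^K` under true nulls (`b = false`) and under false nulls (`b = true`). -/
noncomputable def condMass (g : (Fin K → ℝ) → ℝ) (b : Bool) (A : Set (Fin K → ℝ)) : ℝ :=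
  if b then ∫ x in A, g x else volume.real A

lemma pairLaw_real {a : ℝ} (ha : a ∈ Set.Ioo (0 : ℝ) 1) (hg : ContinuousOn g (cube K))
    (hg0 : ∀ x ∈ cube K, 0 ≤ g x) (b : Bool) {A : Set (Fin K → ℝ)} (hA : MeasurableSet A) :
    (pairLaw a g).real {z | z.1 = b ∧ z.2 ∈ A} =
      (if b then a else 1 - a) * condMass g b (cube K ∩ A) := by
  have e : {z : Bool × (Fin K → ℝ) | z.1 = b ∧ z.2 ∈ A} = {b} ×ˢ A := by
    ext z; simp
  have hvol : (volume.restrict (cube K)) A = volume (cube K ∩ A) := by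
    rw [Measure.restrict_apply hA, Set.inter_comm]
  have halt : altLaw g A = ENNReal.ofReal (∫ x in cube K ∩ A, g x) := by
    rw [altLaw, withDensity_apply _ hA, Measure.restrict_restrict hA, Set.inter_comm,
      ofReal_integral_eq_lintegral_ofReal
        (integrableOn_of_subset_cube hg Set.inter_subset_left)]
    exact (ae_restrict_mem ((measurableSet_cube K).inter hA)).mono fun x hx => hg0 x hx.1
  have : SFinite (altLaw g) := by unfold altLaw; infer_instance
  rw [e, Measure.real, pairLaw, Measure.add_apply, Measure.smul_apply, Measure.smul_apply,
    Measure.prod_prod, Measure.prod_prod, hvol, halt]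
  have hnn : 0 ≤ ∫ x in cube K ∩ A, g x :=
    setIntegral_nonneg ((measurableSet_cube K).inter hA) fun x hx => hg0 x hx.1
  cases b
  · simp [condMass, Measure.real, ENNReal.toReal_mul, ENNReal.toReal_ofReal (sub_nonneg.2 ha.2.le)]
  · simp [condMass, ENNReal.toReal_mul, ENNReal.toReal_ofReal ha.1.le,
      ENNReal.toReal_ofReal hnn]

lemma pairLaw_score_le {a : ℝ} (ha : a ∈ Set.Ioo (0 : ℝ) 1) [IsProbabilityMeasure (pairLaw a g)]
    (hg : ContinuousOn g (cube K)) (hg0 : ∀ x ∈ cube K, 0 ≤ g x) (hS : UniformScore S) {t : ℝ}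
    (ht : t ∈ Set.Icc (0 : ℝ) 1) :
    (pairLaw a g).real {z | S z.2 ≤ t} = (1 - a) * t + a * mass g S t := by
  have hm : MeasurableSet {x | S x ≤ t} := hS.measurable measurableSet_Iic
  have e : {z : Bool × (Fin K → ℝ) | S z.2 ≤ t} =
      {z | z.1 = false ∧ z.2 ∈ {x | S x ≤ t}} ∪ {z | z.1 = true ∧ z.2 ∈ {x | S x ≤ t}} := by
    ext z
    simp only [Set.mem_ofPred_eq, Set.mem_union]
    cases z.1 <;> simp
  rw [e, measureReal_union, pairLaw_real ha hg hg0 _ hm, pairLaw_real ha hg hg0 _ hm]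
  · have h2 := hS.volume_region t ht
    change (1 - a) * volume.real (region S t) + a * mass g S t = _
    rw [h2]
  · rw [Set.disjoint_left]
    rintro z hz hz'
    simp [hz.1] at hz'
  · exact (measurableSet_eq_fun measurable_fst measurable_const).inter (measurable_snd hm)

end Model

/-! ### Almost sure limits of thresholds and rejection counts; limits of the power -/

section Convergence

variable {K : ℕ} {g S T : (Fin K → ℝ) → ℝ} {a α s₀ t₀ : ℝ} {Ω : Type*} [MeasurableSpace Ω]
  {P : Measure Ω} {θ : ℕ → Ω → Bool} {ξ : ℕ → Ω → Fin K → ℝ}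

lemma RandomEffectsModel.measurable_pair (hM : RandomEffectsModel P a g θ ξ) (i : ℕ) :
    Measurable fun ω => (θ i ω, ξ i ω) :=
  (hM.measurable_θ i).prodMk (hM.measurable_ξ i)

/-- The nulls with `θ_i = b`. -/
def nullsOf (b : Bool) (n : ℕ) (θ : ℕ → Bool) : Finset ℕ :=
  (Finset.range n).filter (fun i => θ i = b)

lemma measurable_card {n : ℕ} {X : Ω → Finset ℕ} (hX : ∀ ω, X ω ⊆ Finset.range n)
    (hm : ∀ i, MeasurableSet {ω | i ∈ X ω}) : Measurable fun ω => ((X ω).card : ℝ) := by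
  classical
  have : (fun ω => ((X ω).card : ℝ)) =
      fun ω => ∑ i ∈ Finset.range n, {ω | i ∈ X ω}.indicator (fun _ => (1 : ℝ)) ω := by
    ext ω
    simp only [Set.indicator_apply, Set.mem_ofPred_eq, Finset.sum_boole]
    rw [Finset.filter_mem_eq_inter, Finset.inter_eq_right.2 (hX ω)]
  rw [this]
  exact Finset.measurable_sum _ fun i _ => measurable_const.indicator (hm i)

lemma RandomEffectsModel.measurableSet_mem_nullsOf (hM : RandomEffectsModel P a g θ ξ) (b : Bool)
    (n i : ℕ) : MeasurableSet {ω | i ∈ nullsOf b n (fun i => θ i ω)} := by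
  simp only [nullsOf, Finset.mem_filter]
  exact (MeasurableSet.const _).inter (measurableSet_eq_fun (hM.measurable_θ i) measurable_const)

lemma RandomEffectsModel.measurableSet_mem_rejected (hM : RandomEffectsModel P a g θ ξ)
    (hα : 0 < α) (hS : Measurable S) (b : Bool) (n i : ℕ) :
    MeasurableSet {ω | i ∈ bhRejected α n (fun i => S (ξ i ω)) ∩
      nullsOf b n (fun i => θ i ω)} := by
  simp only [Finset.mem_inter]
  exact (measurableSet_mem_bhRejected (fun i => hS.comp (hM.measurable_ξ i)) hα n i).inter
    (hM.measurableSet_mem_nullsOf b n i)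

variable [IsProbabilityMeasure P]

lemma RandomEffectsModel.isProbabilityMeasure (hM : RandomEffectsModel P a g θ ξ) :
    IsProbabilityMeasure (pairLaw a g) :=
  hM.law 0 ▸ Measure.isProbabilityMeasure_map (hM.measurable_pair 0).aemeasurable

lemma RandomEffectsModel.ae_tendsto_threshold (hM : RandomEffectsModel P a g θ ξ)
    (ha : a ∈ Set.Ioo (0 : ℝ) 1) (hg : ContinuousOn g (cube K)) (hg0 : ∀ x ∈ cube K, 0 ≤ g x)
    (hα : 0 < α) (hS : UniformScore S) (hs : IsCrossing a α (mass g S) s₀) :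
    ∀ᵐ ω ∂P, Tendsto (fun n => threshold (fun t => Set.Iic t) α n (fun i => S (ξ i ω))) atTop
      (𝓝 s₀) := by
  have := hM.isProbabilityMeasure
  have h : ∀ᵐ ω ∂P, ∀ q : ℚ, Tendsto (freq {z | S z.2 ≤ (q : ℝ)} (fun i => (θ i ω, ξ i ω))) atTop
      (𝓝 ((pairLaw a g).real {z | S z.2 ≤ (q : ℝ)})) :=
    ae_all_iff.2 fun q => ae_tendsto_freq hM.measurable_pair hM.indep hM.law
      ((hS.measurable.comp measurable_snd) measurableSet_Iic)
  filter_upwards [h] with ω hω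
  refine tendsto_threshold (F := fun t => (1 - a) * t + a * mass g S t) hα (fun q hq => ?_) ?_
    hs.mem hs.below hs.above
  · have := hω q
    rw [pairLaw_score_le ha hg hg0 hS hq] at this
    exact this
  · exact (continuousOn_const.mul continuousOn_id).add
      (continuousOn_const.mul (hS.continuousOn_mass hg))

lemma continuousAt_pairLaw_score (ha : a ∈ Set.Ioo (0 : ℝ) 1)
    [IsProbabilityMeasure (pairLaw a g)] (hg : ContinuousOn g (cube K))
    (hg0 : ∀ x ∈ cube K, 0 ≤ g x) (hS : UniformScore S) (hs₀ : s₀ ∈ Set.Ioo (0 : ℝ) 1) :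
    ContinuousAt (fun t => (pairLaw a g).real {z | S z.2 ≤ t}) s₀ := by
  have hn := Icc_mem_nhds hs₀.1 hs₀.2
  have : ContinuousAt (fun t => (1 - a) * t + a * mass g S t) s₀ :=
    ((continuousOn_const.mul continuousOn_id).add
      (continuousOn_const.mul (hS.continuousOn_mass hg))).continuousAt hn
  refine this.congr ?_
  filter_upwards [hn] with t ht
  rw [pairLaw_score_le ha hg hg0 hS ht]

/-- All later limits are instances of this one: S = T gives the count of a single procedure, and `b`
selects false or true nulls. -/
lemma RandomEffectsModel.ae_tendsto_card_inter (hM : RandomEffectsModel P a g θ ξ)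
    (ha : a ∈ Set.Ioo (0 : ℝ) 1) (hg : ContinuousOn g (cube K)) (hg0 : ∀ x ∈ cube K, 0 ≤ g x)
    (hα : 0 < α) (hS : UniformScore S) (hs : IsCrossing a α (mass g S) s₀)
    (hT : UniformScore T) (ht : IsCrossing a α (mass g T) t₀) (b : Bool) :
    ∀ᵐ ω ∂P, Tendsto (fun n : ℕ =>
      (((bhRejected α n (fun i => S (ξ i ω)) ∩ nullsOf b n (fun i => θ i ω)) ∩
        (bhRejected α n (fun i => T (ξ i ω)) ∩ nullsOf b n (fun i => θ i ω))).card : ℝ) / n) atTop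
      (𝓝 ((if b then a else 1 - a) * condMass g b (region S s₀ ∩ region T t₀))) := by
  classical
  have := hM.isProbabilityMeasure
  have hC : MeasurableSet {z : Bool × (Fin K → ℝ) | z.1 = b} :=
    measurableSet_eq_fun measurable_fst measurable_const
  have hS2 := hS.measurable.comp (measurable_snd : Measurable (Prod.snd : Bool × (Fin K → ℝ) → _))
  have hT2 := hT.measurable.comp (measurable_snd : Measurable (Prod.snd : Bool × (Fin K → ℝ) → _))
  have h : ∀ᵐ ω ∂P, ∀ q r : ℚ, Tendsto (freq {z : Bool × (Fin K → ℝ) |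
      z ∈ {z : Bool × (Fin K → ℝ) | z.1 = b} ∧ S z.2 ≤ (q : ℝ) ∧ T z.2 ≤ (r : ℝ)}
        (fun i => (θ i ω, ξ i ω))) atTop (𝓝 ((pairLaw a g).real {z |
      z ∈ {z : Bool × (Fin K → ℝ) | z.1 = b} ∧ S z.2 ≤ (q : ℝ) ∧ T z.2 ≤ (r : ℝ)})) :=
    ae_all_iff.2 fun q => ae_all_iff.2 fun r =>
      ae_tendsto_freq hM.measurable_pair hM.indep hM.law
        (hC.inter ((hS2 measurableSet_Iic).inter (hT2 measurableSet_Iic)))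
  filter_upwards [h, hM.ae_tendsto_threshold ha hg hg0 hα hS hs,
    hM.ae_tendsto_threshold ha hg hg0 hα hT ht] with ω h1 h2 h3
  have h4 := tendsto_freq_of_tendsto (S := fun z : Bool × (Fin K → ℝ) => S z.2)
    (T := fun z : Bool × (Fin K → ℝ) => T z.2) (C := {z | z.1 = b})
    (H := fun s t => (pairLaw a g).real {z | z ∈ {z : Bool × (Fin K → ℝ) | z.1 = b} ∧
      S z.2 ≤ s ∧ T z.2 ≤ t}) (x := fun i => (θ i ω, ξ i ω)) h2 h3 h1
    (continuousAt_measureReal_inter _ hS2 hT2 hC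
      (continuousAt_pairLaw_score ha hg hg0 hS hs.mem)
      (continuousAt_pairLaw_score ha hg hg0 hT ht.mem))
  have e : (pairLaw a g).real {z | z ∈ {z : Bool × (Fin K → ℝ) | z.1 = b} ∧ S z.2 ≤ s₀ ∧
      T z.2 ≤ t₀} = (if b then a else 1 - a) * condMass g b (region S s₀ ∩ region T t₀) := by
    have h5 := pairLaw_real ha hg hg0 b (A := {x | S x ≤ s₀} ∩ {x | T x ≤ t₀})
      ((hS.measurable measurableSet_Iic).inter (hT.measurable measurableSet_Iic))
    have h6 : region S s₀ ∩ region T t₀ = cube K ∩ ({x | S x ≤ s₀} ∩ {x | T x ≤ t₀}) := by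
      ext x; simp only [region, Set.mem_inter_iff, Set.mem_ofPred_eq]; tauto
    rw [h6, ← h5]
    rfl
  rw [e] at h4
  refine h4.congr fun n => ?_
  rw [freq_eq_card]
  congr 3
  ext i
  simp only [Finset.mem_filter, Finset.mem_range, Set.mem_ofPred_eq, Finset.mem_inter,
    mem_bhRejected, nullsOf]
  tauto

lemma nullsOf_subset_range (b : Bool) (n : ℕ) (θ : ℕ → Bool) : nullsOf b n θ ⊆ Finset.range n :=
  Finset.filter_subset _ _

/-- Reduces the relative difference to cardinalities whose limits
`RandomEffectsModel.ae_tendsto_card_inter` provides. -/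
lemma relDiff_eq (A B : Finset ℕ) : relDiff A B =
    ((A.card : ℝ) + B.card - 2 * (A ∩ B).card) / (A ∩ B).card := by
  have h1 : (symmDiff A B).card = (A \ B).card + (B \ A).card :=
    Finset.card_union_of_disjoint disjoint_sdiff_sdiff
  have h2 := Finset.card_sdiff_add_card_inter A B
  have h3 := Finset.card_sdiff_add_card_inter B A
  rw [Finset.inter_comm] at h3
  rw [relDiff, h1, ← h2, ← h3]
  push_cast
  ring_nf

/-- The relative difference of `region S s` and `region T t`, with respect to the law of the
p-values under true nulls (`b = false`) or false nulls (`b = true`). -/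
noncomputable def limitRelDiff (g : (Fin K → ℝ) → ℝ) (b : Bool) (A B : Set (Fin K → ℝ)) : ℝ :=
  (condMass g b A + condMass g b B - 2 * condMass g b (A ∩ B)) / condMass g b (A ∩ B)

lemma RandomEffectsModel.tendstoInMeasure_relDiff (hM : RandomEffectsModel P a g θ ξ)
    (ha : a ∈ Set.Ioo (0 : ℝ) 1) (hg : ContinuousOn g (cube K)) (hg0 : ∀ x ∈ cube K, 0 ≤ g x)
    (hα : 0 < α) (hS : UniformScore S) (hs : IsCrossing a α (mass g S) s₀)
    (hT : UniformScore T) (ht : IsCrossing a α (mass g T) t₀) (b : Bool)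
    (hpos : condMass g b (region S s₀ ∩ region T t₀) ≠ 0) :
    TendstoInMeasure P (fun n ω => relDiff
        (bhRejected α n (fun i => S (ξ i ω)) ∩ nullsOf b n (fun i => θ i ω))
        (bhRejected α n (fun i => T (ξ i ω)) ∩ nullsOf b n (fun i => θ i ω)))
      atTop (fun _ => limitRelDiff g b (region S s₀) (region T t₀)) := by
  have hab : (if b then a else 1 - a) ≠ 0 := by
    cases b
    · simpa using (sub_pos.2 ha.2).ne'
    · simpa using ha.1.ne'
  refine tendstoInMeasure_of_tendsto_ae (fun n => Measurable.aestronglyMeasurable ?_) ?_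
  · have hA := hM.measurableSet_mem_rejected hα hS.measurable b n
    have hB := hM.measurableSet_mem_rejected hα hT.measurable b n
    refine Measurable.div (measurable_card (n := n) ?_ fun i => ?_)
      (measurable_card (n := n) ?_ fun i => ?_)
    · intro ω i hi
      rw [Finset.mem_symmDiff] at hi
      rcases hi with hi | hi <;>
        exact nullsOf_subset_range _ _ _ (Finset.mem_inter.1 hi.1).2
    · simp only [Finset.mem_symmDiff]
      exact ((hA i).inter (hB i).compl).union ((hB i).inter (hA i).compl)
    · exact fun ω i hi => nullsOf_subset_range _ _ _
        (Finset.mem_inter.1 (Finset.mem_inter.1 hi).1).2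
    · simp only [Finset.mem_inter (s₁ := bhRejected α n _ ∩ _)]
      exact (hA i).inter (hB i)
  · filter_upwards [hM.ae_tendsto_card_inter ha hg hg0 hα hS hs hT ht b,
      hM.ae_tendsto_card_inter ha hg hg0 hα hS hs hS hs b,
      hM.ae_tendsto_card_inter ha hg hg0 hα hT ht hT ht b] with ω h1 h2 h3
    simp only [Finset.inter_self, Set.inter_self] at h2 h3
    have h4 := ((h2.add h3).sub (h1.const_mul 2)).div h1 (mul_ne_zero hab hpos)
    have e : limitRelDiff g b (region S s₀) (region T t₀) =
        ((if b then a else 1 - a) * condMass g b (region S s₀) +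
          (if b then a else 1 - a) * condMass g b (region T t₀) -
          2 * ((if b then a else 1 - a) * condMass g b (region S s₀ ∩ region T t₀))) /
          ((if b then a else 1 - a) * condMass g b (region S s₀ ∩ region T t₀)) := by
      rw [limitRelDiff]
      field_simp
    rw [e]
    refine h4.congr' ?_
    filter_upwards [eventually_gt_atTop 0] with n hn
    have hn' : (n : ℝ) ≠ 0 := by positivity
    simp only [Pi.div_apply]
    rw [relDiff_eq, ← mul_div_assoc, ← add_div, ← sub_div, div_div_div_cancel_right₀ hn']

lemma RandomEffectsModel.ae_tendsto_card_nulls (hM : RandomEffectsModel P a g θ ξ)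
    (ha : a ∈ Set.Ioo (0 : ℝ) 1) (hg : ContinuousOn g (cube K)) (hg0 : ∀ x ∈ cube K, 0 ≤ g x)
    (hg1 : ∫ x in cube K, g x = 1) :
    ∀ᵐ ω ∂P, Tendsto (fun n : ℕ => ((nullsOf true n (fun i => θ i ω)).card : ℝ) / n) atTop
      (𝓝 a) := by
  classical
  filter_upwards [ae_tendsto_freq hM.measurable_pair hM.indep hM.law
    (C := {z | z.1 = true ∧ z.2 ∈ Set.univ})
    ((measurableSet_eq_fun measurable_fst measurable_const).inter
      (measurable_snd MeasurableSet.univ))] with ω hω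
  rw [pairLaw_real ha hg hg0 true MeasurableSet.univ] at hω
  simp only [condMass, if_true, Set.inter_univ, hg1, mul_one] at hω
  refine hω.congr fun n => ?_
  rw [freq_eq_card]
  simp [nullsOf]

/-- Dominated convergence: the ratio is at most 1, and after division by n its numerator and
denominator tend almost surely to a Φ(s₀) and a. -/
lemma RandomEffectsModel.tendsto_power (hM : RandomEffectsModel P a g θ ξ)
    (ha : a ∈ Set.Ioo (0 : ℝ) 1) (hg : ContinuousOn g (cube K)) (hg0 : ∀ x ∈ cube K, 0 ≤ g x)
    (hg1 : ∫ x in cube K, g x = 1)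
    (hα : 0 < α) (hS : UniformScore S) (hs : IsCrossing a α (mass g S) s₀) :
    Tendsto (power P θ ξ (fun n x => bhRejected α n (fun i => S (x i)))) atTop
      (𝓝 (mass g S s₀)) := by
  have key := tendsto_integral_of_dominated_convergence (μ := P)
    (F := fun n ω => ((bhRejected α n (fun i => S (ξ i ω)) ∩
      nullsOf true n (fun i => θ i ω)).card : ℝ) /
        (max (nullsOf true n (fun i => θ i ω)).card 1 : ℕ))
    (f := fun _ => mass g S s₀) (fun _ => 1) (fun n => ?_) (integrable_const _)
    (fun n => ae_of_all _ fun ω => ?_) ?_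
  · rw [integral_const, probReal_univ, one_smul] at key
    exact key
  · refine Measurable.aestronglyMeasurable (Measurable.div (measurable_card (n := n) ?_
      (hM.measurableSet_mem_rejected hα hS.measurable true n)) ?_)
    · exact fun ω i hi => nullsOf_subset_range _ _ _ (Finset.mem_inter.1 hi).2
    · simp only [Nat.cast_max]
      exact (measurable_card (fun ω => nullsOf_subset_range _ _ _)
        (hM.measurableSet_mem_nullsOf true n)).max measurable_const
  · rw [Real.norm_eq_abs, abs_of_nonneg (by positivity)]
    refine div_le_one_of_le₀ ?_ (by positivity)
    exact_mod_cast (Finset.card_le_card Finset.inter_subset_right).trans (le_max_left _ _)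
  · filter_upwards [hM.ae_tendsto_card_inter ha hg hg0 hα hS hs hS hs true,
      hM.ae_tendsto_card_nulls ha hg hg0 hg1] with ω h1 h2
    simp only [Finset.inter_self, Set.inter_self, if_true, condMass] at h1
    have h3 := h1.div h2 ha.1.ne'
    rw [mul_div_cancel_left₀ _ ha.1.ne'] at h3
    refine h3.congr' ?_
    filter_upwards [h2.eventually_const_lt ha.1, eventually_gt_atTop 0] with n h4 hn
    have hn' : (n : ℝ) ≠ 0 := by positivity
    have h5 : 1 ≤ (nullsOf true n (fun i => θ i ω)).card := by
      by_contra h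
      have : (nullsOf true n (fun i => θ i ω)).card = 0 := by omega
      simp [this] at h4
    simp only [Pi.div_apply]
    rw [max_eq_left h5, div_div_div_cancel_right₀ hn']

end Convergence

/-! ### Weighted balls -/

section Ball

open scoped Pointwise

variable {K : ℕ} {ε : ℝ} {γ : Fin K → ℝ}

/-- The part `{x ∈ [0,1]^K : γ' x^ε ≤ u}` of the weighted ball that lies in the cube. -/
def ball (ε : ℝ) (γ : Fin K → ℝ) (u : ℝ) : Set (Fin K → ℝ) :=
  {x | x ∈ cube K ∧ weightedSum ε γ x ≤ u}

lemma ballVol_eq (ε : ℝ) (γ : Fin K → ℝ) (u : ℝ) : ballVol ε γ u = volume.real (ball ε γ u) := rfl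

lemma ball_subset_cube (u : ℝ) : ball ε γ u ⊆ cube K := fun _ h => h.1

lemma ball_mono {u v : ℝ} (h : u ≤ v) : ball ε γ u ⊆ ball ε γ v := fun _ hx => ⟨hx.1, hx.2.trans h⟩

lemma continuous_weightedSum (hε : 0 < ε) : Continuous (weightedSum ε γ) :=
  continuous_finsetSum _ fun k _ =>
    continuous_const.mul ((continuous_apply k).rpow_const fun _ => Or.inr hε.le)

lemma measurableSet_ball (hε : 0 < ε) (u : ℝ) : MeasurableSet (ball ε γ u) :=
  (measurableSet_cube K).inter ((continuous_weightedSum hε).measurable measurableSet_Iic)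

lemma ballVol_nonneg (u : ℝ) : 0 ≤ ballVol ε γ u := measureReal_nonneg

lemma ballVol_mono : Monotone (ballVol ε γ) := fun _ _ h =>
  measureReal_mono (ball_mono h) (volume_ne_top_of_subset_cube (ball_subset_cube _))

lemma mul_rpow_le_weightedSum (hγ : ∀ k, 0 < γ k) {x : Fin K → ℝ} (hx : x ∈ cube K) (k : Fin K) :
    γ k * x k ^ ε ≤ weightedSum ε γ x :=
  Finset.single_le_sum (f := fun k => γ k * x k ^ ε)
    (fun i _ => mul_nonneg (hγ i).le (Real.rpow_nonneg (hx.1 i) _)) (Finset.mem_univ k)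

lemma weightedSum_nonneg (hγ : ∀ k, 0 < γ k) {x : Fin K → ℝ} (hx : x ∈ cube K) :
    0 ≤ weightedSum ε γ x :=
  Finset.sum_nonneg fun i _ => mul_nonneg (hγ i).le (Real.rpow_nonneg (hx.1 i) _)

lemma weightedSum_le_sum (hε : 0 < ε) (hγ : ∀ k, 0 < γ k) {x : Fin K → ℝ} (hx : x ∈ cube K) :
    weightedSum ε γ x ≤ ∑ k, γ k :=
  Finset.sum_le_sum fun k _ => mul_le_of_le_one_right (hγ k).le
    (Real.rpow_le_one (hx.1 k) (hx.2 k) hε.le)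

lemma weightedSum_smul {c : ℝ} (hc : 0 ≤ c) {x : Fin K → ℝ} (hx : x ∈ cube K) :
    weightedSum ε γ (c • x) = c ^ ε * weightedSum ε γ x := by
  rw [weightedSum, weightedSum, Finset.mul_sum]
  refine Finset.sum_congr rfl fun k _ => ?_
  rw [Pi.smul_apply, smul_eq_mul, Real.mul_rpow hc (hx.1 k)]
  ring

lemma mul_norm_rpow_le_weightedSum (hK : 1 ≤ K) (hγ : ∀ k, 0 < γ k) {m : ℝ}
    (hm : ∀ k, m ≤ γ k) {x : Fin K → ℝ} (hx : x ∈ cube K) :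
    m * ‖x‖ ^ ε ≤ weightedSum ε γ x := by
  have : Nonempty (Fin K) := ⟨⟨0, hK⟩⟩
  obtain ⟨k, hk⟩ : ∃ k, ‖x‖ = x k := by
    obtain ⟨k, hk⟩ := Finite.exists_max x
    refine ⟨k, le_antisymm ((pi_norm_le_iff_of_nonneg (hx.1 k)).2 fun i => ?_)
      ((le_abs_self _).trans (norm_le_pi_norm x k))⟩
    rw [Real.norm_of_nonneg (hx.1 i)]
    exact hk i
  rw [hk]
  exact (mul_le_mul_of_nonneg_right (hm k) (Real.rpow_nonneg (hx.1 k) _)).trans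
    (mul_rpow_le_weightedSum hγ hx k)

lemma rpow_inv_pow {l : ℝ} (hl : 0 ≤ l) : (l ^ ε⁻¹) ^ K = l ^ ((K : ℝ) / ε) := by
  rw [← Real.rpow_natCast, ← Real.rpow_mul hl, div_eq_inv_mul]

lemma smul_mem_cube {c : ℝ} (hc : 0 ≤ c) (hc1 : c ≤ 1) {x : Fin K → ℝ} (hx : x ∈ cube K) :
    c • x ∈ cube K :=
  ⟨fun k => mul_nonneg hc (hx.1 k), fun k => mul_le_one₀ hc1 (hx.1 k) (hx.2 k)⟩

/-- Scaling x by l^(1/ε) multiplies γ'x^ε by l. In general only an inclusion holds, because the cube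
truncates the balls. -/
lemma smul_ball_subset (hε : 0 < ε) {l u : ℝ} (hl : 0 ≤ l) (hl1 : l ≤ 1) :
    (l ^ ε⁻¹) • ball ε γ u ⊆ ball ε γ (l * u) := by
  rintro _ ⟨x, hx, rfl⟩
  have h0 : 0 ≤ l ^ ε⁻¹ := Real.rpow_nonneg hl _
  refine ⟨smul_mem_cube h0 (Real.rpow_le_one hl hl1 (inv_nonneg.2 hε.le)) hx.1, ?_⟩
  change weightedSum ε γ ((l ^ ε⁻¹) • x) ≤ _
  rw [weightedSum_smul h0 hx.1, Real.rpow_inv_rpow hl hε.ne']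
  exact mul_le_mul_of_nonneg_left hx.2 hl

/-- For u ≤ min γ_k the faces x_k = 1 do not truncate the ball: γ_k x_k^ε ≤ u ≤ γ_k already forces
x_k ≤ 1. -/
lemma smul_ball_eq (hε : 0 < ε) (hγ : ∀ k, 0 < γ k) {l u : ℝ} (hl : 0 < l) (hl1 : l ≤ 1)
    (hu : ∀ k, u ≤ γ k) : (l ^ ε⁻¹) • ball ε γ u = ball ε γ (l * u) := by
  refine (smul_ball_subset hε hl.le hl1).antisymm fun x hx => ?_
  have h0 : 0 < l ^ ε⁻¹ := Real.rpow_pos_of_pos hl _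
  rw [Set.mem_smul_set_iff_inv_smul_mem₀ h0.ne']
  have hle : ∀ k, γ k * (((l ^ ε⁻¹)⁻¹ • x) k) ^ ε = l⁻¹ * (γ k * x k ^ ε) := by
    intro k
    rw [Pi.smul_apply, smul_eq_mul, Real.mul_rpow (inv_nonneg.2 h0.le) (hx.1.1 k),
      Real.inv_rpow h0.le, Real.rpow_inv_rpow hl.le hε.ne']
    ring
  have hnn : ∀ k, 0 ≤ ((l ^ ε⁻¹)⁻¹ • x) k := fun k => mul_nonneg (inv_nonneg.2 h0.le) (hx.1.1 k)
  have hsum : weightedSum ε γ ((l ^ ε⁻¹)⁻¹ • x) ≤ u := by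
    rw [weightedSum, Finset.sum_congr rfl fun k _ => hle k, ← Finset.mul_sum, inv_mul_le_iff₀ hl]
    exact hx.2
  refine ⟨⟨hnn, fun k => ?_⟩, hsum⟩
  have h1 : γ k * (((l ^ ε⁻¹)⁻¹ • x) k) ^ ε ≤ γ k * 1 := by
    rw [mul_one]
    exact ((Finset.single_le_sum (f := fun k => γ k * (((l ^ ε⁻¹)⁻¹ • x) k) ^ ε)
      (fun i _ => mul_nonneg (hγ i).le (Real.rpow_nonneg (hnn i) _)) (Finset.mem_univ k)).trans
        hsum).trans (hu k)
  have h2 := le_of_mul_le_mul_left h1 (hγ k)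
  by_contra h3
  exact absurd h2 (not_le.2 (Real.one_lt_rpow (not_le.1 h3) hε))

lemma volume_real_smul_ball {l : ℝ} (hl : 0 ≤ l) (u : ℝ) :
    volume.real ((l ^ ε⁻¹) • ball ε γ u) = l ^ ((K : ℝ) / ε) * ballVol ε γ u := by
  rw [Measure.real, Measure.addHaar_smul, Module.finrank_fin_fun, rpow_inv_pow hl,
    abs_of_nonneg (Real.rpow_nonneg hl _), ENNReal.toReal_mul,
    ENNReal.toReal_ofReal (Real.rpow_nonneg hl _)]
  rfl

lemma rpow_mul_ballVol_le (hε : 0 < ε) {l : ℝ} (u : ℝ) (hl : 0 ≤ l) (hl1 : l ≤ 1) :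
    l ^ ((K : ℝ) / ε) * ballVol ε γ u ≤ ballVol ε γ (l * u) := by
  rw [← volume_real_smul_ball hl]
  exact measureReal_mono (smul_ball_subset hε hl hl1)
    (volume_ne_top_of_subset_cube (ball_subset_cube _))

lemma ballVol_mul (hε : 0 < ε) (hγ : ∀ k, 0 < γ k) {l u : ℝ} (hl : 0 < l) (hl1 : l ≤ 1)
    (hu : ∀ k, u ≤ γ k) : ballVol ε γ (l * u) = l ^ ((K : ℝ) / ε) * ballVol ε γ u := by
  rw [← volume_real_smul_ball hl.le, smul_ball_eq hε hγ hl hl1 hu]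
  rfl

lemma setIntegral_weightedSum_mul (hε : 0 < ε) (hγ : ∀ k, 0 < γ k) {l u : ℝ} (hl : 0 < l)
    (hl1 : l ≤ 1) (hu : ∀ k, u ≤ γ k) :
    ∫ x in ball ε γ (l * u), weightedSum ε γ x =
      l ^ ((K : ℝ) / ε) * (l * ∫ x in ball ε γ u, weightedSum ε γ x) := by
  have h0 : 0 < l ^ ε⁻¹ := Real.rpow_pos_of_pos hl _
  have hp : 0 < l ^ ((K : ℝ) / ε) := Real.rpow_pos_of_pos hl _
  have h := Measure.setIntegral_comp_smul volume (weightedSum ε γ) (ball ε γ u) h0.ne'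
  rw [smul_ball_eq hε hγ hl hl1 hu, Module.finrank_fin_fun, rpow_inv_pow hl.le,
    abs_of_nonneg (inv_nonneg.2 hp.le), smul_eq_mul] at h
  have h2 : ∫ x in ball ε γ u, weightedSum ε γ ((l ^ ε⁻¹) • x) =
      l * ∫ x in ball ε γ u, weightedSum ε γ x := by
    rw [← integral_const_mul]
    refine setIntegral_congr_fun (measurableSet_ball hε u) fun x hx => ?_
    rw [weightedSum_smul h0.le hx.1, Real.rpow_inv_rpow hl.le hε.ne']
  rw [← h2, h, mul_inv_cancel_left₀ hp.ne']

lemma ballVol_sum (hε : 0 < ε) (hγ : ∀ k, 0 < γ k) : ballVol ε γ (∑ k, γ k) = 1 := by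
  have : ball ε γ (∑ k, γ k) = cube K :=
    (ball_subset_cube _).antisymm fun x hx => ⟨hx, weightedSum_le_sum hε hγ hx⟩
  rw [ballVol_eq, this, Measure.real, volume_cube, ENNReal.toReal_one]

lemma exists_pos_le (hK : 1 ≤ K) (hγ : ∀ k, 0 < γ k) : ∃ m, 0 < m ∧ ∀ k, m ≤ γ k := by
  have : Nonempty (Fin K) := ⟨⟨0, hK⟩⟩
  obtain ⟨k, hk⟩ := Finite.exists_min γ
  exact ⟨γ k, hγ k, hk⟩

/-- The cube is the ball of radius ∑ γ_k, and a scaled copy of it fits into every smaller ball. -/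
lemma ballVol_pos (hK : 1 ≤ K) (hε : 0 < ε) (hγ : ∀ k, 0 < γ k) {u : ℝ} (hu : 0 < u) :
    0 < ballVol ε γ u := by
  have hG : 0 < ∑ k, γ k := Finset.sum_pos (fun k _ => hγ k) ⟨⟨0, hK⟩, Finset.mem_univ _⟩
  have hl : 0 < min 1 (u / ∑ k, γ k) := lt_min one_pos (div_pos hu hG)
  have h := rpow_mul_ballVol_le (γ := γ) hε (∑ k, γ k) hl.le (min_le_left _ _)
  rw [ballVol_sum hε hγ, mul_one] at h
  refine ((Real.rpow_pos_of_pos hl _).trans_le h).trans_le (ballVol_mono ?_)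
  rw [← le_div_iff₀ hG]
  exact min_le_right _ _

lemma tendsto_rpow_mul_nhds_zero (hK : 1 ≤ K) (hε : 0 < ε) (c : ℝ) :
    Tendsto (fun l : ℝ => l ^ ((K : ℝ) / ε) * c) (𝓝 0) (𝓝 0) := by
  have hp : 0 < (K : ℝ) / ε := div_pos (by exact_mod_cast hK) hε
  have h := ((Real.continuous_rpow_const hp.le).tendsto 0).mul_const c
  rwa [Real.zero_rpow hp.ne', zero_mul] at h

lemma exists_ballVol_lt (hK : 1 ≤ K) (hε : 0 < ε) (hγ : ∀ k, 0 < γ k) {e : ℝ} (he : 0 < e) :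
    ∃ u > 0, ballVol ε γ u < e := by
  obtain ⟨m, hm, hmγ⟩ := exists_pos_le hK hγ
  have h := ((tendsto_rpow_mul_nhds_zero hK hε (ballVol ε γ m)).mono_left
    (nhdsWithin_le_nhds (s := Set.Ioi 0))).eventually_lt_const he
  obtain ⟨l, hl, hl1, hl0⟩ := (h.and (Ioo_mem_nhdsGT (zero_lt_one' ℝ))).exists
  exact ⟨l * m, mul_pos hl1 hm, by rwa [ballVol_mul hε hγ hl1 hl0.le hmγ]⟩

lemma ballVol_zero (hK : 1 ≤ K) (hε : 0 < ε) (hγ : ∀ k, 0 < γ k) : ballVol ε γ 0 = 0 := by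
  refine le_antisymm (le_of_forall_pos_lt_add fun e he => ?_) (ballVol_nonneg 0)
  obtain ⟨u, hu, h⟩ := exists_ballVol_lt hK hε hγ he
  rw [zero_add]
  exact (ballVol_mono hu.le).trans_lt h

/-- At u > 0 the scaling inequality, applied to the pair (u, v) in both orders, squeezes the volume
at v between multiples of the volume at u that tend to 1. -/
lemma continuousOn_ballVol (hK : 1 ≤ K) (hε : 0 < ε) (hγ : ∀ k, 0 < γ k) :
    ContinuousOn (ballVol ε γ) (Set.Ici 0) := by
  intro u hu
  rcases (Set.mem_Ici.1 hu).eq_or_lt with rfl | hu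
  · rw [ContinuousWithinAt, ballVol_zero hK hε hγ]
    refine tendsto_order.2 ⟨fun b hb => Eventually.of_forall fun v =>
      hb.trans_le (ballVol_nonneg v), fun b hb => ?_⟩
    obtain ⟨v, hv, h⟩ := exists_ballVol_lt hK hε hγ hb
    filter_upwards [mem_nhdsWithin_of_mem_nhds (Iio_mem_nhds hv)] with x hx
    exact (ballVol_mono (le_of_lt hx)).trans_lt h
  · refine ContinuousAt.continuousWithinAt ?_
    have hp : 0 ≤ (K : ℝ) / ε := by positivity
    have hlow : Tendsto (fun v => (min 1 (v / u)) ^ ((K : ℝ) / ε) * ballVol ε γ u) (𝓝 u)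
        (𝓝 (ballVol ε γ u)) := by
      have h : Continuous fun v => (min 1 (v / u)) ^ ((K : ℝ) / ε) * ballVol ε γ u :=
        ((continuous_const.min (continuous_id.div_const u)).rpow_const
          fun _ => Or.inr hp).mul continuous_const
      have := h.tendsto u
      simpa [div_self hu.ne'] using this
    have hhigh : Tendsto (fun v => ((min 1 (u / v)) ^ ((K : ℝ) / ε))⁻¹ * ballVol ε γ u) (𝓝 u)
        (𝓝 (ballVol ε γ u)) := by
      have h : ContinuousAt (fun v => ((min 1 (u / v)) ^ ((K : ℝ) / ε))⁻¹ * ballVol ε γ u) u := by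
        refine ContinuousAt.mul (ContinuousAt.inv₀ (ContinuousAt.rpow_const
          (continuousAt_const.min (continuousAt_const.div continuousAt_id hu.ne'))
          (Or.inr hp)) ?_) continuousAt_const
        simp [div_self hu.ne']
      have := h.tendsto
      simpa [div_self hu.ne'] using this
    refine tendsto_of_tendsto_of_tendsto_of_le_of_le' hlow hhigh ?_ ?_
    · filter_upwards [lt_mem_nhds hu] with v hv
      refine (rpow_mul_ballVol_le hε u (le_min zero_le_one (div_pos hv hu).le)
        (min_le_left _ _)).trans (ballVol_mono ?_)
      rw [← le_div_iff₀ hu]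
      exact min_le_right _ _
    · filter_upwards [lt_mem_nhds hu] with v hv
      have hl : 0 < min 1 (u / v) := lt_min one_pos (div_pos hu hv)
      rw [le_inv_mul_iff₀ (Real.rpow_pos_of_pos hl _)]
      refine (rpow_mul_ballVol_le hε v hl.le (min_le_left _ _)).trans (ballVol_mono ?_)
      rw [← le_div_iff₀ hv]
      exact min_le_right _ _

/-- The scores to which the approximate procedure applies the Benjamini-Hochberg procedure. -/
noncomputable def ballScore (ε : ℝ) (γ : Fin K → ℝ) (x : Fin K → ℝ) : ℝ :=
  ballVol ε γ (weightedSum ε γ x)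

/-- The radius is the largest one in [0, ∑ γ_k] with volume t. This choice absorbs any flat piece of
the volume function, so strict monotonicity is not needed. -/
lemma exists_region_ballScore_eq (hK : 1 ≤ K) (hε : 0 < ε) (hγ : ∀ k, 0 < γ k) {t : ℝ}
    (ht : t ∈ Set.Icc (0 : ℝ) 1) :
    ∃ u, 0 ≤ u ∧ ballVol ε γ u = t ∧ region (ballScore ε γ) t = ball ε γ u := by
  have hG : 0 ≤ ∑ k, γ k := Finset.sum_nonneg fun k _ => (hγ k).le
  have hc : ContinuousOn (ballVol ε γ) (Set.Icc 0 (∑ k, γ k)) :=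
    (continuousOn_ballVol hK hε hγ).mono Set.Icc_subset_Ici_self
  have hne : (Set.Icc 0 (∑ k, γ k) ∩ ballVol ε γ ⁻¹' {t}).Nonempty := by
    obtain ⟨u, hu, h⟩ := intermediate_value_Icc hG hc (show t ∈ _ by
      rwa [ballVol_zero hK hε hγ, ballVol_sum hε hγ])
    exact ⟨u, hu, h⟩
  obtain ⟨u, hu⟩ := (isCompact_Icc.of_isClosed_subset
    (hc.preimage_isClosed_of_isClosed isClosed_Icc isClosed_singleton)
    Set.inter_subset_left).exists_isGreatest hne
  have hut : ballVol ε γ u = t := hu.1.2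
  refine ⟨u, hu.1.1.1, hut, Set.ext fun x => and_congr_right fun hx => ⟨fun h => ?_, fun h => ?_⟩⟩
  · by_contra hlt
    have h1 : t ≤ ballVol ε γ (weightedSum ε γ x) := hut ▸ ballVol_mono (not_le.1 hlt).le
    exact hlt (hu.2 ⟨⟨weightedSum_nonneg hγ hx, weightedSum_le_sum hε hγ hx⟩, le_antisymm h h1⟩)
  · exact (ballVol_mono h).trans hut.le

lemma uniformScore_ballScore (hK : 1 ≤ K) (hε : 0 < ε) (hγ : ∀ k, 0 < γ k) :
    UniformScore (ballScore ε γ) := by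
  refine ⟨ballVol_mono.measurable.comp (continuous_weightedSum hε).measurable, fun t ht => ?_⟩
  obtain ⟨u, -, hu, h⟩ := exists_region_ballScore_eq hK hε hγ ht
  rw [h, ← hu]
  rfl

lemma integrableOn_weightedSum (hε : 0 < ε) {A : Set (Fin K → ℝ)} (hA : A ⊆ cube K) :
    IntegrableOn (weightedSum ε γ) A :=
  integrableOn_of_subset_cube (continuous_weightedSum hε).continuousOn hA

/-- The mean of `γ' x^ε` over a small weighted ball is a fixed proportion of its radius. -/
lemma exists_mean_weightedSum (hK : 1 ≤ K) (hε : 0 < ε) (hγ : ∀ k, 0 < γ k) {m : ℝ} (hm : 0 < m)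
    (hmγ : ∀ k, m ≤ γ k) :
    ∃ c ∈ Set.Ioo (0 : ℝ) 1, ∀ u ∈ Set.Ioc 0 m,
      ∫ x in ball ε γ u, weightedSum ε γ x = c * u * ballVol ε γ u := by
  have hV := ballVol_pos hK hε hγ hm
  have hp : 0 < (K : ℝ) / ε := div_pos (by exact_mod_cast hK) hε
  have hhalf : ballVol ε γ (m / 2) = (1 / 2 : ℝ) ^ ((K : ℝ) / ε) * ballVol ε γ m := by
    rw [← ballVol_mul hε hγ (by norm_num) (by norm_num) hmγ, one_div_mul_eq_div]
  have hlt : ballVol ε γ (m / 2) < ballVol ε γ m := by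
    rw [hhalf]
    exact mul_lt_of_lt_one_left hV (Real.rpow_lt_one (by norm_num) (by norm_num) hp)
  have hsub : ball ε γ (m / 2) ⊆ ball ε γ m := ball_mono (by linarith)
  have hvd : volume.real (ball ε γ m \ ball ε γ (m / 2)) = ballVol ε γ m - ballVol ε γ (m / 2) :=
    measureReal_sdiff hsub (measurableSet_ball hε _)
      (volume_ne_top_of_subset_cube (ball_subset_cube _))
  have hdm : MeasurableSet (ball ε γ m \ ball ε γ (m / 2)) :=
    (measurableSet_ball hε _).diff (measurableSet_ball hε _)
  have hdc : ball ε γ m \ ball ε γ (m / 2) ⊆ cube K := Set.sdiff_subset.trans (ball_subset_cube _)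
  have hid := integrableOn_weightedSum (γ := γ) hε hdc
  have hsplit := setIntegral_sdiff (measurableSet_ball hε (m / 2))
    (integrableOn_weightedSum (γ := γ) hε (ball_subset_cube m)) hsub
  have h1 := mul_volume_le_setIntegral hid hdm hdc (c := m / 2)
    fun x hx => (not_le.1 fun h => hx.2 ⟨hx.1.1, h⟩).le
  have h2 := setIntegral_le_mul_volume hid hdm hdc (c := m) fun x hx => hx.1.2
  have h3 := setIntegral_le_mul_volume (integrableOn_weightedSum (γ := γ) hε
    (ball_subset_cube (m / 2))) (measurableSet_ball hε _) (ball_subset_cube _)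
    (c := m / 2) fun x hx => hx.2
  have h4 : 0 ≤ ∫ x in ball ε γ (m / 2), weightedSum ε γ x :=
    setIntegral_nonneg (measurableSet_ball hε _) fun x hx => weightedSum_nonneg hγ hx.1
  have hV2 := ballVol_pos hK hε hγ (half_pos hm)
  rw [hvd] at h1 h2
  rw [← ballVol_eq] at h3
  have hmV : 0 < m * ballVol ε γ m := mul_pos hm hV
  -- The proportion is read off at radius m and carried to smaller radii by scaling. It is positive
  -- because the shell beyond m / 2 has positive volume, and below 1 because the ball of radius m /
  -- 2 has.
  refine ⟨(∫ x in ball ε γ m, weightedSum ε γ x) / (m * ballVol ε γ m), ⟨?_, ?_⟩, ?_⟩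
  · refine div_pos ?_ hmV
    nlinarith [mul_pos (half_pos hm) (sub_pos.2 hlt)]
  · rw [div_lt_one hmV]
    nlinarith [mul_pos (half_pos hm) hV2]
  · intro u hu
    have hl : 0 < u / m := div_pos hu.1 hm
    have hl1 : u / m ≤ 1 := (div_le_one hm).2 hu.2
    have e : u = u / m * m := (div_mul_cancel₀ _ hm.ne').symm
    have e1 := setIntegral_weightedSum_mul hε hγ hl hl1 hmγ
    have e2 := ballVol_mul hε hγ hl hl1 hmγ
    rw [← e] at e1 e2
    rw [e1, e2]
    field_simp

end Ball

/-! ### Scores from superlevel sets -/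

section Superlevel

variable {K : ℕ} {g : (Fin K → ℝ) → ℝ}

lemma zero_mem_cube : (0 : Fin K → ℝ) ∈ cube K := ⟨le_rfl, zero_le_one⟩

lemma superlevel_subset_cube (u : ℝ) : superlevel g u ⊆ cube K := fun _ h => h.1

lemma superlevelVol_antitone : Antitone (superlevelVol g) := fun _ _ h =>
  measureReal_mono (fun _ hx => ⟨hx.1, h.trans hx.2⟩)
    (volume_ne_top_of_subset_cube (superlevel_subset_cube _))

lemma superlevelVol_zero (hg0 : ∀ x ∈ cube K, 0 ≤ g x) : superlevelVol g 0 = 1 := by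
  have : superlevel g 0 = cube K :=
    (superlevel_subset_cube _).antisymm fun x hx => ⟨hx, hg0 x hx⟩
  rw [superlevelVol, this, Measure.real, volume_cube, ENNReal.toReal_one]

lemma le_apply_zero (hmax : ∀ x ∈ cube K, x ≠ 0 → g x < g 0) {x : Fin K → ℝ} (hx : x ∈ cube K) :
    g x ≤ g 0 := by
  rcases eq_or_ne x 0 with rfl | h
  · exact le_rfl
  · exact (hmax x hx h).le

lemma volume_singleton_zero (hK : 1 ≤ K) : volume ({0} : Set (Fin K → ℝ)) = 0 := by
  have : Nonempty (Fin K) := ⟨⟨0, hK⟩⟩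
  exact measure_singleton 0

lemma superlevelVol_apply_zero (hK : 1 ≤ K) (hmax : ∀ x ∈ cube K, x ≠ 0 → g x < g 0) :
    superlevelVol g (g 0) = 0 := by
  have : superlevel g (g 0) ⊆ {0} := fun x hx => by
    by_contra h
    exact absurd hx.2 (not_le.2 (hmax x hx.1 h))
  rw [superlevelVol, Measure.real, measure_mono_null this (volume_singleton_zero hK),
    ENNReal.toReal_zero]

lemma one_le_apply_zero (hg : ContinuousOn g (cube K))
    (hg1 : ∫ x in cube K, g x = 1) (hmax : ∀ x ∈ cube K, x ≠ 0 → g x < g 0) : 1 ≤ g 0 := by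
  have h := setIntegral_le_mul_volume (integrableOn_of_subset_cube hg subset_rfl)
    (measurableSet_cube K) subset_rfl fun x hx => le_apply_zero hmax hx
  rwa [hg1, Measure.real, volume_cube, ENNReal.toReal_one, mul_one] at h

/-- What is assumed of the density, apart from its expansion at the origin. -/
structure IsPeaked (g : (Fin K → ℝ) → ℝ) : Prop where
  one_le : 1 ≤ K
  nonneg : ∀ x ∈ cube K, 0 ≤ g x
  integral_eq : ∫ x in cube K, g x = 1
  cont : ContinuousOn g (cube K)
  lt_zero : ∀ x ∈ cube K, x ≠ 0 → g x < g 0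

/-- The scores for which the procedure based on superlevel sets is a Benjamini-Hochberg
procedure. -/
noncomputable def levelScore (g : (Fin K → ℝ) → ℝ) : (Fin K → ℝ) → ℝ :=
  open Classical in (cube K).piecewise (fun x => superlevelVol g (g x)) (fun _ => 2)

lemma levelScore_of_mem {x : Fin K → ℝ} (hx : x ∈ cube K) :
    levelScore g x = superlevelVol g (g x) := by
  classical
  exact Set.piecewise_eq_of_mem _ _ _ hx

lemma measurable_levelScore (hg : ContinuousOn g (cube K)) : Measurable (levelScore g) := by
  classical
  have h1 : Measurable ((cube K).piecewise g 0) :=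
    hg.measurable_piecewise continuousOn_const (measurableSet_cube K)
  have h2 : Measurable ((cube K).piecewise (superlevelVol g ∘ (cube K).piecewise g 0)
      fun _ => (2 : ℝ)) := Measurable.piecewise (measurableSet_cube K)
    ((superlevelVol_antitone (g := g)).measurable.comp h1) measurable_const
  convert h2 using 1
  ext x
  by_cases hx : x ∈ cube K
  · simp [levelScore, hx]
  · simp [levelScore, hx]

lemma superlevelInv_le {t u : ℝ} (hu : 0 ≤ u) (h : superlevelVol g u ≤ t) :
    superlevelInv g t ≤ u :=
  csInf_le ⟨0, fun _ hv => hv.1⟩ ⟨hu, h⟩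

lemma superlevelInv_nonneg (t : ℝ) : 0 ≤ superlevelInv g t :=
  Real.sInf_nonneg fun _ h => h.1

variable (hp : IsPeaked g) (hl : ContinuousOn (superlevelVol g) (Set.Ici 0))
include hp

lemma IsPeaked.apply_zero_pos : 0 < g 0 :=
  zero_lt_one.trans_le (one_le_apply_zero hp.cont hp.integral_eq hp.lt_zero)

lemma IsPeaked.nonempty_superlevelInv {t : ℝ} (ht : 0 ≤ t) :
    {u : ℝ | 0 ≤ u ∧ superlevelVol g u ≤ t}.Nonempty :=
  ⟨g 0, hp.apply_zero_pos.le, by rwa [superlevelVol_apply_zero hp.one_le hp.lt_zero]⟩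

lemma IsPeaked.le_superlevelInv {t c : ℝ} (ht : 0 ≤ t) (h : t < superlevelVol g c) :
    c ≤ superlevelInv g t := by
  refine le_csInf (hp.nonempty_superlevelInv ht) fun u hu => ?_
  by_contra hlt
  exact absurd (h.trans_le (superlevelVol_antitone (not_le.1 hlt).le)) (not_lt.2 hu.2)

include hl

/-- Here continuity of h enters: the infimum is attained, and just below it h exceeds t, so h equals
t there. If the infimum is 0, then h(0) = 1 ≥ t suffices. -/
lemma IsPeaked.superlevelVol_superlevelInv {t : ℝ} (ht : t ∈ Set.Icc (0 : ℝ) 1) :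
    superlevelVol g (superlevelInv g t) = t := by
  have hcl : IsClosed {u : ℝ | 0 ≤ u ∧ superlevelVol g u ≤ t} :=
    hl.preimage_isClosed_of_isClosed isClosed_Ici isClosed_Iic
  have hmem := hcl.csInf_mem (hp.nonempty_superlevelInv ht.1) ⟨0, fun _ hv => hv.1⟩
  refine le_antisymm hmem.2 ?_
  rcases (superlevelInv_nonneg t).eq_or_lt with h0 | h0
  · rw [← h0, superlevelVol_zero hp.nonneg]
    exact ht.2
  · have hc : ContinuousAt (superlevelVol g) (superlevelInv g t) := hl.continuousAt (Ici_mem_nhds h0)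
    refine ge_of_tendsto (b := t) 
      (hc.tendsto.mono_left (nhdsWithin_le_nhds (s := Set.Iio (superlevelInv g t)))) ?_
    filter_upwards [Ioo_mem_nhdsLT h0] with u hu
    by_contra h
    exact absurd (superlevelInv_le hu.1.le (not_le.1 h).le) (not_le.2 hu.2)

lemma IsPeaked.superlevelVol_le_iff {t : ℝ} (ht : t ∈ Set.Icc (0 : ℝ) 1) {x : Fin K → ℝ}
    (hx : x ∈ cube K) : superlevelVol g (g x) ≤ t ↔ superlevelInv g t ≤ g x :=
  ⟨superlevelInv_le (hp.nonneg x hx), fun h => (superlevelVol_antitone h).trans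
    (hp.superlevelVol_superlevelInv hl ht).le⟩

lemma IsPeaked.region_levelScore {t : ℝ} (ht : t ∈ Set.Icc (0 : ℝ) 1) :
    region (levelScore g) t = superlevel g (superlevelInv g t) := by
  refine Set.ext fun x => and_congr_right fun hx => ?_
  rw [levelScore_of_mem hx]
  exact hp.superlevelVol_le_iff hl ht hx

lemma IsPeaked.uniformScore_levelScore : UniformScore (levelScore g) := by
  refine ⟨measurable_levelScore hp.cont, fun t ht => ?_⟩
  rw [hp.region_levelScore hl ht]
  exact hp.superlevelVol_superlevelInv hl ht

lemma IsPeaked.mem_superlevel_iff {t : ℝ} (ht : t ∈ Set.Icc (0 : ℝ) 1) (x : Fin K → ℝ) :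
    x ∈ superlevel g (superlevelInv g t) ↔ levelScore g x ≤ t := by
  rw [← hp.region_levelScore hl ht]
  refine ⟨fun h => h.2, fun h => ⟨?_, h⟩⟩
  -- Off the cube the score has the value 2, which no threshold in `[0, 1]` reaches.
  by_contra hx
  have : levelScore g x = 2 := by
    classical
    exact Set.piecewise_eq_of_notMem _ _ _ hx
  linarith [ht.2]

/-- The two families of regions are matched only for t in [0, 1], but the definition of the
threshold involves no other t. -/
lemma IsPeaked.optRejected_eq {α : ℝ} (hα : 0 < α) (n : ℕ) (x : ℕ → Fin K → ℝ) :
    optRejected g α n x = bhRejected α n (fun i => levelScore g (x i)) := by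
  have hc : ∀ t ∈ Set.Icc (0 : ℝ) 1,
      count (fun t => superlevel g (superlevelInv g t)) n x t =
        count (fun t => Set.Iic t) n (fun i => levelScore g (x i)) t := by
    intro t ht
    unfold count
    congr 1
    ext i
    simp only [Finset.mem_filter, Set.mem_Iic, hp.mem_superlevel_iff hl ht]
  have hτ : threshold (fun t => superlevel g (superlevelInv g t)) α n x =
      threshold (fun t => Set.Iic t) α n (fun i => levelScore g (x i)) := by
    unfold threshold
    congr 1
    refine Set.ext fun t => and_congr_right fun ht => ?_
    rw [hc t ht]
  ext i
  rw [mem_bhRejected]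
  simp only [optRejected, rejected, Finset.mem_filter, Finset.mem_range]
  rw [hτ, hp.mem_superlevel_iff hl (threshold_mem hα n _).1]

lemma IsPeaked.superlevelInv_lt {s t : ℝ} (hs : 0 ≤ s) (hst : s < t) (ht : t ≤ 1) :
    superlevelInv g t < superlevelInv g s := by
  by_contra h
  have h1 := superlevelVol_antitone (g := g) (not_lt.1 h)
  rw [hp.superlevelVol_superlevelInv hl ⟨hs.trans hst.le, ht⟩,
    hp.superlevelVol_superlevelInv hl ⟨hs, hst.le.trans ht⟩] at h1
  linarith

end Superlevel

/-! ### Mean densities over the regions of a score -/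

section Mean

variable {K : ℕ} {g S : (Fin K → ℝ) → ℝ}

/-- Adding a shell on which the density is at most c lowers a mean that exceeds c. -/
lemma UniformScore.mass_div_lt (hS : UniformScore S) (hg : ContinuousOn g (cube K)) {s t c : ℝ}
    (hs : 0 < s) (hst : s < t) (ht : t ≤ 1) (h : ∀ x ∈ region S t \ region S s, g x ≤ c)
    (hc : c * s < mass g S s) : mass g S t / t < mass g S s / s := by
  have hsub : region S t \ region S s ⊆ cube K := fun x hx => hx.1.1
  have h1 := setIntegral_le_mul_volume (integrableOn_of_subset_cube hg hsub)
    ((hS.measurableSet_region t).diff (hS.measurableSet_region s)) hsub h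
  rw [← hS.mass_sub hg hst.le, hS.volume_shell hs.le hst.le ht] at h1
  rw [div_lt_div_iff₀ (hs.trans hst) hs]
  nlinarith [mul_pos (sub_pos.2 hst) (sub_pos.2 hc)]

lemma UniformScore.mul_le_mass (hS : UniformScore S) (hg : ContinuousOn g (cube K)) {t c : ℝ}
    (ht : t ∈ Set.Icc (0 : ℝ) 1) (h : ∀ x ∈ region S t, c ≤ g x) : c * t ≤ mass g S t := by
  have h1 := mul_volume_le_setIntegral (integrableOn_of_subset_cube hg (region_subset_cube S t))
    (hS.measurableSet_region t) (region_subset_cube S t) h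
  rwa [hS.volume_region t ht] at h1

lemma IsPeaked.mass_lt (hp : IsPeaked g) (hS : UniformScore S) {t : ℝ}
    (ht : t ∈ Set.Ioc (0 : ℝ) 1) : mass g S t / t < g 0 := by
  have hv := hS.volume_region t ⟨ht.1.le, ht.2⟩
  have hm := hS.measurableSet_region t
  have hig := integrableOn_of_subset_cube hp.cont (region_subset_cube S t)
  have hic : IntegrableOn (fun _ : Fin K → ℝ => g 0) (region S t) :=
    integrableOn_const (volume_ne_top_of_subset_cube (region_subset_cube S t))
  have hpos : 0 < ∫ x in region S t, (g 0 - g x) := by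
    have hnn : 0 ≤ᵐ[volume.restrict (region S t)] fun x => g 0 - g x :=
      (ae_restrict_mem hm).mono fun x hx => sub_nonneg.2 (le_apply_zero hp.lt_zero hx.1)
    refine (setIntegral_pos_iff_support_of_nonneg_ae hnn (hic.sub hig)).2 ?_
    · have hsub : region S t \ {0} ⊆ (Function.support fun x => g 0 - g x) ∩ region S t :=
        fun x hx => ⟨(sub_pos.2 (hp.lt_zero x hx.1.1 hx.2)).ne', hx.1⟩
      refine lt_of_lt_of_le ?_ (measure_mono hsub)
      rw [measure_sdiff_null (volume_singleton_zero hp.one_le)]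
      refine pos_iff_ne_zero.2 fun h0 => ?_
      rw [Measure.real, h0, ENNReal.toReal_zero] at hv
      exact ht.1.ne hv
  rw [integral_sub hic hig, setIntegral_const, hv, smul_eq_mul] at hpos
  rw [div_lt_iff₀ ht.1, mul_comm]
  exact sub_pos.1 hpos

/-- The value that the mean density has at a crossing. -/
noncomputable def crossLevel (a α : ℝ) : ℝ := (1 / α - (1 - a)) / a

lemma div_lt_iff_crossLevel_lt {a α t y : ℝ} (ha : 0 < a) (ht : 0 < t) :
    t / α < (1 - a) * t + a * y ↔ crossLevel a α < y / t := by
  rw [crossLevel, div_lt_div_iff₀ ha ht, ← sub_pos, ← sub_pos (b := (1 / α - (1 - a)) * t)]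
  ring_nf

lemma lt_div_iff_lt_crossLevel {a α t y : ℝ} (ha : 0 < a) (ht : 0 < t) :
    (1 - a) * t + a * y < t / α ↔ y / t < crossLevel a α := by
  rw [crossLevel, div_lt_div_iff₀ ht ha, ← sub_pos, ← sub_pos (a := (1 / α - (1 - a)) * t)]
  ring_nf

lemma div_eq_iff_crossLevel_eq {a α t y : ℝ} (ha : 0 < a) (ht : 0 < t) :
    t / α = (1 - a) * t + a * y ↔ y / t = crossLevel a α := by
  rw [crossLevel, div_eq_div_iff ht.ne' ha.ne', ← sub_eq_zero,
    ← sub_eq_zero (b := (1 / α - (1 - a)) * t), ← neg_eq_zero]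
  ring_nf

/-- On (0, ρ] the mean density is continuous and strictly decreasing and passes through the crossing
level; from ρ on it stays below that level. So it meets the level exactly once. -/
lemma UniformScore.exists_isCrossing (hS : UniformScore S) (hg : ContinuousOn g (cube K))
    {a α ρ q : ℝ} (ha : 0 < a) (hρ : ρ ∈ Set.Ioc (0 : ℝ) 1)
    (hanti : StrictAntiOn (fun t => mass g S t / t) (Set.Ioc 0 ρ))
    (hq : ∀ t ∈ Set.Icc ρ 1, mass g S t / t ≤ q) (hqα : q < crossLevel a α)
    {t' : ℝ} (ht' : t' ∈ Set.Ioo 0 ρ) (hbig : crossLevel a α < mass g S t' / t') :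
    ∃ t₀, IsCrossing a α (mass g S) t₀ := by
  have hc : ContinuousOn (fun t => mass g S t / t) (Set.Icc t' ρ) :=
    ((hS.continuousOn_mass hg).mono (Set.Icc_subset_Icc ht'.1.le hρ.2)).div continuousOn_id
      fun t ht => (ht'.1.trans_le ht.1).ne'
  obtain ⟨t₀, ht₀, h₀⟩ := intermediate_value_Icc' ht'.2.le hc
    (show crossLevel a α ∈ _ from ⟨((hq ρ ⟨le_rfl, hρ.2⟩).trans_lt hqα).le, hbig.le⟩)
  have h₀' : mass g S t₀ / t₀ = crossLevel a α := h₀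
  have hpos : 0 < t₀ := ht'.1.trans_le ht₀.1
  have hlt : t₀ < ρ := ht₀.2.lt_of_ne fun h => by
    subst h
    exact absurd (hq t₀ ⟨le_rfl, hρ.2⟩) (not_le.2 (hqα.trans_eq h₀'.symm))
  refine ⟨t₀, ⟨hpos, hlt.trans_le hρ.2⟩, fun t ht => ?_,
    (div_eq_iff_crossLevel_eq ha hpos).2 h₀', fun t ht => ?_⟩
  · rw [div_lt_iff_crossLevel_lt ha ht.1, ← h₀']
    exact hanti ⟨ht.1, (ht.2.trans hlt).le⟩ ⟨hpos, hlt.le⟩ ht.2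
  · rw [lt_div_iff_lt_crossLevel ha (hpos.trans ht.1)]
    rcases le_total t ρ with h | h
    · rw [← h₀']
      exact hanti ⟨hpos, hlt.le⟩ ⟨hpos.trans ht.1, h⟩ ht.1
    · exact (hq t ⟨h, ht.2⟩).trans_lt hqα

lemma IsCrossing.lt_of_div_lt {a α t₀ t : ℝ} {Φ : ℝ → ℝ} (h : IsCrossing a α Φ t₀) (ha : 0 < a)
    (ht : 0 < t) (hlt : Φ t / t < crossLevel a α) : t₀ < t := by
  by_contra hle
  rcases (not_lt.1 hle).eq_or_lt with rfl | h1
  · exact hlt.ne ((div_eq_iff_crossLevel_eq ha ht).1 h.eq)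
  · exact hlt.not_gt ((div_lt_iff_crossLevel_lt ha ht).1 (h.below t ⟨ht, h1⟩))

/-- The regions of `S` shrink to places where `g` is close to its maximum. -/
def ConcentratesAtPeak (g S : (Fin K → ℝ) → ℝ) : Prop :=
  ∀ c < g 0, ∃ t₁ > 0, ∀ t ∈ Set.Ioo 0 t₁, ∀ x ∈ region S t, c ≤ g x

lemma ConcentratesAtPeak.exists_lt_mass_div (hS : UniformScore S) (h : ConcentratesAtPeak g S)
    (hg : ContinuousOn g (cube K)) {c ρ : ℝ} (hc : c < g 0) (hρ : ρ ∈ Set.Ioc (0 : ℝ) 1) :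
    ∃ t ∈ Set.Ioo 0 ρ, c < mass g S t / t := by
  obtain ⟨c', h1, h2⟩ := exists_between hc
  obtain ⟨t₁, ht₁, H⟩ := h c' h2
  obtain ⟨t, ht0, ht⟩ := exists_between (lt_min ht₁ hρ.1)
  rw [lt_min_iff] at ht
  refine ⟨t, ⟨ht0, ht.2⟩, h1.trans_le ?_⟩
  rw [le_div_iff₀ ht0]
  exact hS.mul_le_mass hg ⟨ht0.le, ht.2.le.trans hρ.2⟩ (H t ⟨ht0, ht.1⟩)

/-- Outside the region at level s the density is at most h^*(s). Inside it is at least h^*(s), and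
on the inner region at level s / 2 at least h^*(s / 2) > h^*(s), so the mean strictly exceeds
h^*(s). -/
lemma IsPeaked.strictAntiOn_mass_levelScore (hp : IsPeaked g)
    (hl : ContinuousOn (superlevelVol g) (Set.Ici 0)) :
    StrictAntiOn (fun t => mass g (levelScore g) t / t) (Set.Ioc 0 1) := by
  intro s hs t ht hst
  have hS := hp.uniformScore_levelScore hl
  have hs' : s ∈ Set.Icc (0 : ℝ) 1 := ⟨hs.1.le, hs.2⟩
  have hs2 : s / 2 ∈ Set.Icc (0 : ℝ) 1 := ⟨by linarith [hs.1], by linarith [hs.2]⟩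
  refine hS.mass_div_lt hp.cont hs.1 hst ht.2 (c := superlevelInv g s) (fun x hx => ?_) ?_
  · rw [hp.region_levelScore hl hs'] at hx
    exact (not_le.1 fun h => hx.2 ⟨hx.1.1, h⟩).le
  · have h1 := hS.mul_le_mass hp.cont hs2 (c := superlevelInv g (s / 2)) fun x hx => by
      rw [hp.region_levelScore hl hs2] at hx
      exact hx.2
    have hsub : region (levelScore g) s \ region (levelScore g) (s / 2) ⊆ cube K :=
      fun x hx => hx.1.1
    have h2 := mul_volume_le_setIntegral (integrableOn_of_subset_cube hp.cont hsub)
      ((hS.measurableSet_region s).diff (hS.measurableSet_region _)) hsub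
      (c := superlevelInv g s) fun x hx => by
        have := hx.1
        rw [hp.region_levelScore hl hs'] at this
        exact this.2
    rw [← hS.mass_sub hp.cont (by linarith [hs.1]),
      hS.volume_shell hs2.1 (by linarith [hs.1]) hs.2] at h2
    have h3 := hp.superlevelInv_lt hl hs2.1 (show s / 2 < s by linarith [hs.1]) hs.2
    nlinarith [mul_pos (half_pos hs.1) (sub_pos.2 h3)]

lemma IsPeaked.mass_levelScore_one (hp : IsPeaked g) : mass g (levelScore g) 1 = 1 := by
  have e : region (levelScore g) 1 = cube K := by
    refine (region_subset_cube _ _).antisymm fun x hx => ⟨hx, ?_⟩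
    rw [levelScore_of_mem hx, ← superlevelVol_zero hp.nonneg]
    exact superlevelVol_antitone (hp.nonneg x hx)
  rw [mass, e, hp.integral_eq]

lemma IsPeaked.one_lt_apply_zero (hp : IsPeaked g)
    (hl : ContinuousOn (superlevelVol g) (Set.Ici 0)) : 1 < g 0 := by
  have h := hp.mass_lt (hp.uniformScore_levelScore hl) (t := 1) ⟨one_pos, le_rfl⟩
  rwa [hp.mass_levelScore_one, div_one] at h

end Mean

/-! ### Balls and superlevel sets around the peak -/

section Peak

variable {K : ℕ} {g : (Fin K → ℝ) → ℝ} {ε : ℝ} {γ : Fin K → ℝ}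

lemma exists_ball_norm_lt (hK : 1 ≤ K) (hε : 0 < ε) (hγ : ∀ k, 0 < γ k) {δ : ℝ} (hδ : 0 < δ) :
    ∃ u > 0, ∀ x ∈ ball ε γ u, ‖x‖ < δ := by
  obtain ⟨m, hm, hmγ⟩ := exists_pos_le hK hγ
  have hδε : 0 < δ ^ ε := Real.rpow_pos_of_pos hδ _
  refine ⟨m * (δ ^ ε / 2), by positivity, fun x hx => ?_⟩
  have h := (mul_norm_rpow_le_weightedSum hK hγ hmγ hx.1).trans hx.2
  have h1 := le_of_mul_le_mul_left h hm
  exact (Real.rpow_lt_rpow_iff (norm_nonneg x) hδ.le hε).1 (by linarith)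

lemma eventually_nhdsWithin_cube (hK : 1 ≤ K) (hε : 0 < ε) (hγ : ∀ k, 0 < γ k)
    {p : (Fin K → ℝ) → Prop} (h : ∀ᶠ x in 𝓝[cube K] 0, p x) : ∃ u > 0, ∀ x ∈ ball ε γ u, p x := by
  obtain ⟨δ, hδ, H⟩ := Metric.mem_nhdsWithin_iff.1 h
  obtain ⟨u, hu, hu2⟩ := exists_ball_norm_lt hK hε hγ hδ
  exact ⟨u, hu, fun x hx => H ⟨by simpa using hu2 x hx, hx.1⟩⟩

lemma IsPeaked.exists_ball_lt (hp : IsPeaked g) (hε : 0 < ε) (hγ : ∀ k, 0 < γ k) {c : ℝ}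
    (hc : c < g 0) : ∃ u > 0, ∀ x ∈ ball ε γ u, c < g x :=
  eventually_nhdsWithin_cube hp.one_le hε hγ ((hp.cont 0 zero_mem_cube).eventually_const_lt hc)

lemma IsPeaked.superlevelVol_pos (hp : IsPeaked g) {c : ℝ} (hc : c < g 0) :
    0 < superlevelVol g c := by
  -- Any weighted ball would serve; exponent and weights 1 are an arbitrary choice.
  obtain ⟨u, hu, H⟩ := hp.exists_ball_lt (ε := 1) (γ := 1) one_pos (fun _ => one_pos) hc
  exact (ballVol_pos hp.one_le one_pos (fun _ => one_pos) hu).trans_le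
    (measureReal_mono (fun x hx => ⟨hx.1, (H x hx).le⟩)
      (volume_ne_top_of_subset_cube (superlevel_subset_cube _)))

lemma IsPeaked.concentrates_levelScore (hp : IsPeaked g)
    (hl : ContinuousOn (superlevelVol g) (Set.Ici 0)) : ConcentratesAtPeak g (levelScore g) := by
  intro c hc
  refine ⟨min 1 (superlevelVol g c), lt_min one_pos (hp.superlevelVol_pos hc),
    fun t ht x hx => ?_⟩
  have ht2 := lt_min_iff.1 ht.2
  rw [hp.region_levelScore hl ⟨ht.1.le, ht2.1.le⟩] at hx
  exact (hp.le_superlevelInv ht.1.le ht2.2).trans hx.2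

lemma IsPeaked.concentrates_ballScore (hp : IsPeaked g) (hε : 0 < ε) (hγ : ∀ k, 0 < γ k) :
    ConcentratesAtPeak g (ballScore ε γ) := by
  intro c hc
  obtain ⟨u, hu, H⟩ := hp.exists_ball_lt hε hγ hc
  refine ⟨min 1 (ballVol ε γ u), lt_min one_pos (ballVol_pos hp.one_le hε hγ hu),
    fun t ht x hx => (H x ?_).le⟩
  have ht2 := lt_min_iff.1 ht.2
  obtain ⟨v, -, hv, h⟩ := exists_region_ballScore_eq hp.one_le hε hγ ⟨ht.1.le, ht2.1.le⟩
  rw [h] at hx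
  exact ball_mono (ballVol_mono.reflect_lt (hv.trans_lt ht2.2)).le hx

/-- The essential supremum is g(0), since every superlevel set below g(0) has positive volume by
continuity at the origin. -/
lemma IsPeaked.alphaStar_eq (hp : IsPeaked g) (a : ℝ) : alphaStar a g = 1 / (1 - a + a * g 0) := by
  have hle : ∀ᵐ x ∂(volume.restrict (cube K)), g x ≤ g 0 :=
    (ae_restrict_mem (measurableSet_cube K)).mono fun x hx => le_apply_zero hp.lt_zero hx
  have hge : ∀ᵐ x ∂(volume.restrict (cube K)), 0 ≤ g x :=
    (ae_restrict_mem (measurableSet_cube K)).mono fun x hx => hp.nonneg x hx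
  have hne : NeZero (volume.restrict (cube K)) :=
    ⟨fun h => by
      have := congrArg (fun μ => μ Set.univ) h
      simp [volume_cube] at this⟩
  have hb : IsBoundedUnder (· ≤ ·) (ae (volume.restrict (cube K))) g := ⟨g 0, hle⟩
  have hcb : IsCoboundedUnder (· ≤ ·) (ae (volume.restrict (cube K))) g :=
    IsBoundedUnder.isCoboundedUnder_le ⟨0, hge⟩
  have hess : essSup g (volume.restrict (cube K)) = g 0 := by
    refine le_antisymm (essSup_le_of_ae_le _ hle hcb) ?_
    by_contra hlt
    obtain ⟨c, h1, h2⟩ := exists_between (not_le.1 hlt)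
    have h3 := ae_lt_of_essSup_lt h1 hb
    have h4 : volume (superlevel g c) = 0 := by
      rw [ae_restrict_iff' (measurableSet_cube K)] at h3
      refine measure_mono_null (fun x hx => ?_) h3
      exact fun h => absurd (h hx.1) (not_lt.2 hx.2)
    have h5 := hp.superlevelVol_pos h2
    rw [superlevelVol, Measure.real, h4, ENNReal.toReal_zero] at h5
    exact lt_irrefl _ h5
  rw [alphaStar, hess]

end Peak

/-! ### Comparison of the two families of regions near the peak -/

section Compare

variable {K : ℕ} {g r : (Fin K → ℝ) → ℝ} {ε : ℝ} {γ : Fin K → ℝ}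

/-- On the cube γ'x^ε dominates a multiple of ‖x‖^ε, so the remainder is also small relative to
γ'x^ε. -/
lemma exists_ball_abs_remainder_le (hK : 1 ≤ K) (hε : 0 < ε) (hγ : ∀ k, 0 < γ k)
    (hr : r =o[𝓝[cube K] 0] (fun x => ‖x‖ ^ ε)) {δ : ℝ} (hδ : 0 < δ) :
    ∃ ρ > 0, ∀ x ∈ ball ε γ ρ, |r x| ≤ δ * weightedSum ε γ x := by
  obtain ⟨m, hm, hmγ⟩ := exists_pos_le hK hγ
  obtain ⟨ρ, hρ, H⟩ := eventually_nhdsWithin_cube hK hε hγ (hr.def (mul_pos hδ hm))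
  refine ⟨ρ, hρ, fun x hx => (H x hx).trans ?_⟩
  rw [Real.norm_of_nonneg (Real.rpow_nonneg (norm_nonneg x) _), mul_assoc]
  exact mul_le_mul_of_nonneg_left (mul_norm_rpow_le_weightedSum hK hγ hmγ hx.1) hδ.le

lemma IsPeaked.deficit_eq (hp : IsPeaked g)
    (hexp : ∀ x ∈ cube K, g x = g 0 * (1 - weightedSum ε γ x + r x)) {x : Fin K → ℝ}
    (hx : x ∈ cube K) : 1 - g x / g 0 = weightedSum ε γ x - r x := by
  rw [hexp x hx, mul_div_cancel_left₀ _ hp.apply_zero_pos.ne']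
  ring

lemma IsPeaked.deficit_mem (hp : IsPeaked g)
    (hexp : ∀ x ∈ cube K, g x = g 0 * (1 - weightedSum ε γ x + r x)) {δ : ℝ} {x : Fin K → ℝ}
    (hx : x ∈ cube K) (hr : |r x| ≤ δ * weightedSum ε γ x) :
    (1 - δ) * weightedSum ε γ x ≤ 1 - g x / g 0 ∧
      1 - g x / g 0 ≤ (1 + δ) * weightedSum ε γ x := by
  rw [hp.deficit_eq hexp hx]
  have := abs_le.1 hr
  constructor <;> linarith

lemma IsPeaked.integral_deficit (hp : IsPeaked g) {A : Set (Fin K → ℝ)} (hA : A ⊆ cube K) :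
    ∫ x in A, (1 - g x / g 0) = volume.real A - (∫ x in A, g x) / g 0 := by
  have hc : IntegrableOn (fun _ : Fin K → ℝ => (1 : ℝ)) A :=
    integrableOn_const (volume_ne_top_of_subset_cube hA)
  rw [integral_sub hc
    ((integrableOn_of_subset_cube hp.cont hA).div_const _), setIntegral_const, integral_div,
    smul_eq_mul, mul_one]

lemma IsPeaked.integral_deficit_mem (hp : IsPeaked g) (hε : 0 < ε)
    (hexp : ∀ x ∈ cube K, g x = g 0 * (1 - weightedSum ε γ x + r x)) {δ : ℝ}
    {A : Set (Fin K → ℝ)} (hm : MeasurableSet A) (hA : A ⊆ cube K)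
    (hr : ∀ x ∈ A, |r x| ≤ δ * weightedSum ε γ x) :
    (1 - δ) * ∫ x in A, weightedSum ε γ x ≤ ∫ x in A, (1 - g x / g 0) ∧
      ∫ x in A, (1 - g x / g 0) ≤ (1 + δ) * ∫ x in A, weightedSum ε γ x := by
  have hw := integrableOn_weightedSum (γ := γ) hε hA
  have hd : IntegrableOn (fun x => 1 - g x / g 0) A :=
    (integrableOn_const (volume_ne_top_of_subset_cube hA)).sub
      ((integrableOn_of_subset_cube hp.cont hA).div_const _)
  rw [← integral_const_mul, ← integral_const_mul]
  exact ⟨setIntegral_mono_on (hw.const_mul _) hd hm fun x hx =>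
      (hp.deficit_mem hexp (hA hx) (hr x hx)).1,
    setIntegral_mono_on hd (hw.const_mul _) hm fun x hx =>
      (hp.deficit_mem hexp (hA hx) (hr x hx)).2⟩

/-- Outside the ball of radius u the relative deficit is at least (1 - δ) u, while its mean inside
is at most (1 + δ) c u, which is smaller for small δ because c < 1. -/
lemma IsPeaked.exists_strictAntiOn_mass_ballScore (hp : IsPeaked g) (hε : 0 < ε)
    (hγ : ∀ k, 0 < γ k) (hexp : ∀ x ∈ cube K, g x = g 0 * (1 - weightedSum ε γ x + r x))
    (hr : r =o[𝓝[cube K] 0] (fun x => ‖x‖ ^ ε)) :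
    ∃ ρ ∈ Set.Ioc (0 : ℝ) 1,
      StrictAntiOn (fun t => mass g (ballScore ε γ) t / t) (Set.Ioc 0 ρ) := by
  obtain ⟨m, hm, hmγ⟩ := exists_pos_le hp.one_le hγ
  obtain ⟨c, hc, hW⟩ := exists_mean_weightedSum hp.one_le hε hγ hm hmγ
  -- Small enough that (1 + δ) c < 1 - δ.
  set δ := (1 - c) / 4 with hδ
  have hδ0 : 0 < δ := by have := hc.2; linarith
  obtain ⟨ρ, hρ, H⟩ := exists_ball_abs_remainder_le hp.one_le hε hγ hr hδ0
  have hV := ballVol_pos hp.one_le hε hγ (lt_min hρ hm)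
  -- Halving the volume makes the comparison of volumes strict, and a strict comparison passes back
  -- to radii by mere monotonicity.
  refine ⟨min 1 (ballVol ε γ (min ρ m) / 2), ⟨lt_min one_pos (by positivity), min_le_left _ _⟩,
    fun s hs t ht hst => ?_⟩
  have hs2 := le_min_iff.1 hs.2
  have ht2 := le_min_iff.1 ht.2
  obtain ⟨u, hu0, hus, hu⟩ := exists_region_ballScore_eq hp.one_le hε hγ ⟨hs.1.le, hs2.1⟩
  obtain ⟨v, hv0, hvt, hv⟩ := exists_region_ballScore_eq hp.one_le hε hγ ⟨ht.1.le, ht2.1⟩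
  have hvle : v ≤ min ρ m := (ballVol_mono.reflect_lt (by rw [hvt]; linarith [ht2.2])).le
  have hule : u ≤ min ρ m := (ballVol_mono.reflect_lt (by rw [hus]; linarith [hs2.2])).le
  have hupos : 0 < u := hu0.lt_of_ne fun h => by
    rw [← h, ballVol_zero hp.one_le hε hγ] at hus
    exact hs.1.ne hus
  have hS := uniformScore_ballScore hp.one_le hε hγ
  have hg0 := hp.apply_zero_pos
  refine hS.mass_div_lt hp.cont hs.1 hst ht2.1 (c := g 0 * (1 - (1 - δ) * u)) (fun x hx => ?_) ?_
  · rw [hu, hv] at hx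
    have hwu : u ≤ weightedSum ε γ x := (not_le.1 fun h => hx.2 ⟨hx.1.1, h⟩).le
    have h1 := (hp.deficit_mem hexp hx.1.1
      (H x (ball_mono (hvle.trans (min_le_left _ _)) hx.1))).1
    have h2 : (1 - δ) * u ≤ 1 - g x / g 0 :=
      (mul_le_mul_of_nonneg_left hwu (by have := hc.1; linarith)).trans h1
    rw [mul_comm, ← div_le_iff₀ hg0]
    linarith
  · have h1 := (hp.integral_deficit_mem hε hexp (measurableSet_ball hε u) (ball_subset_cube u)
      fun x hx => H x (ball_mono (hule.trans (min_le_left _ _)) hx)).2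
    rw [hp.integral_deficit (ball_subset_cube u), hW u ⟨hupos, hule.trans (min_le_right _ _)⟩,
      ← ballVol_eq, hus] at h1
    rw [mass, hu]
    have h2 : s - (1 + δ) * (c * u * s) ≤ (∫ x in ball ε γ u, g x) / g 0 := by linarith
    rw [le_div_iff₀ hg0] at h2
    refine lt_of_lt_of_le ?_ h2
    have h3 : (1 + δ) * c < 1 - δ := by nlinarith [hc.1, hc.2]
    nlinarith [mul_pos (mul_pos hupos hs.1) (mul_pos hg0 (sub_pos.2 h3))]

/-- Confines high superlevel sets to a small ball, where the expansion applies. On the compact rest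
of the cube g attains a maximum, which is below g(0) because the origin is excluded. -/
lemma IsPeaked.exists_lt_of_weightedSum_ge (hp : IsPeaked g) (hε : 0 < ε)
    {ρ : ℝ} (hρ : 0 < ρ) : ∃ c < g 0, ∀ x ∈ cube K, c < g x → weightedSum ε γ x < ρ := by
  have hcl : IsCompact (cube K ∩ weightedSum ε γ ⁻¹' Set.Ici ρ) :=
    (isCompact_cube K).inter_right (isClosed_Ici.preimage (continuous_weightedSum hε))
  rcases (cube K ∩ weightedSum ε γ ⁻¹' Set.Ici ρ).eq_empty_or_nonempty with h | h
  · refine ⟨g 0 - 1, by linarith, fun x hx _ => not_le.1 fun hle => ?_⟩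
    exact Set.eq_empty_iff_forall_notMem.1 h x ⟨hx, hle⟩
  · obtain ⟨x₀, hx₀, hmax⟩ := hcl.exists_isMaxOn h (hp.cont.mono Set.inter_subset_left)
    refine ⟨g x₀, hp.lt_zero x₀ hx₀.1 fun h0 => ?_, fun x hx hlt => not_le.1 fun hle => ?_⟩
    · have := hx₀.2
      rw [h0, Set.mem_preimage, weightedSum] at this
      simp [Real.zero_rpow hε.ne'] at this
      linarith
    · exact absurd (hmax ⟨hx, hle⟩) (not_le.2 hlt)

/-- The radius ratio that a relative error `δ` of the expansion leads to. -/
noncomputable def radiusRatio (p δ : ℝ) : ℝ := ((1 + δ) / (1 - δ)) ^ p * ((1 + δ) / (1 - δ)) ^ 2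

/-- With L the p-th power of the radius ratio, L² + L - 2 is the later bound for the relative
symmetric difference. It is continuous in δ and vanishes at δ = 0. -/
lemma exists_radiusRatio_lt {p e : ℝ} (hp : 0 < p) (he : 0 < e) :
    ∃ δ ∈ Set.Ioo (0 : ℝ) 1, 1 < radiusRatio p δ ∧
      (radiusRatio p δ ^ p) ^ 2 + radiusRatio p δ ^ p - 2 < e := by
  have hc : ContinuousAt (fun δ => (radiusRatio p δ ^ p) ^ 2 + radiusRatio p δ ^ p - 2) 0 := by
    have h1 : ContinuousAt (fun δ : ℝ => (1 + δ) / (1 - δ)) 0 :=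
      (continuousAt_const.add continuousAt_id).div (continuousAt_const.sub continuousAt_id)
        (by simp)
    have h2 : ContinuousAt (radiusRatio p) 0 :=
      (h1.rpow_const (Or.inr hp.le)).mul (h1.pow 2)
    have h3 := h2.rpow_const (p := p) (Or.inr hp.le)
    exact ((h3.pow 2).add h3).sub continuousAt_const
  have h0 : (radiusRatio p 0 ^ p) ^ 2 + radiusRatio p 0 ^ p - 2 < e := by
    simp only [radiusRatio, add_zero, sub_zero, div_one, Real.one_rpow, one_pow, mul_one]
    linarith
  have hev := hc.eventually_lt_const h0
  obtain ⟨δ, h1, hδ⟩ := ((hev.filter_mono (nhdsWithin_le_nhds (s := Set.Ioi 0))).and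
    (Ioo_mem_nhdsGT (zero_lt_one' ℝ))).exists
  refine ⟨δ, hδ, ?_, h1⟩
  have hR : 1 < (1 + δ) / (1 - δ) := by
    rw [one_lt_div (by linarith [hδ.2])]
    linarith [hδ.1]
  exact one_lt_mul_of_lt_of_le (Real.one_lt_rpow hR hp) (one_le_pow₀ hR.le)

/-- If the mean densities over a superlevel set and over a weighted ball near the peak agree, then
the superlevel set lies between two weighted balls of nearly the same radius. -/
lemma IsPeaked.exists_ball_subset_superlevel_subset_ball (hp : IsPeaked g)
    (hl : ContinuousOn (superlevelVol g) (Set.Ici 0)) (hε : 0 < ε) (hγ : ∀ k, 0 < γ k)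
    (hexp : ∀ x ∈ cube K, g x = g 0 * (1 - weightedSum ε γ x + r x))
    (hr : r =o[𝓝[cube K] 0] (fun x => ‖x‖ ^ ε)) {m : ℝ} (hm : 0 < m) (hmγ : ∀ k, m ≤ γ k)
    {δ : ℝ} (hδ : δ ∈ Set.Ioo (0 : ℝ) 1) :
    ∃ t₁ ∈ Set.Ioc (0 : ℝ) 1, ∃ ρ > 0, ∀ s ∈ Set.Ioo 0 t₁, ∀ u ∈ Set.Ioo 0 ρ,
      mass g (levelScore g) s / s = (∫ x in ball ε γ u, g x) / ballVol ε γ u →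
        ball ε γ (u / radiusRatio (K / ε) δ) ⊆ region (levelScore g) s ∧
          region (levelScore g) s ⊆ ball ε γ (radiusRatio (K / ε) δ * u) := by
  obtain ⟨c, hc, hW⟩ := exists_mean_weightedSum hp.one_le hε hγ hm hmγ
  obtain ⟨ρ₀, hρ₀, H⟩ := exists_ball_abs_remainder_le hp.one_le hε hγ hr hδ.1
  have hρ : 0 < min ρ₀ m := lt_min hρ₀ hm
  set ρ := min ρ₀ m with hρdef
  have hH : ∀ x ∈ ball ε γ ρ, |r x| ≤ δ * weightedSum ε γ x :=
    fun x hx => H x (ball_mono (min_le_left _ _) hx)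
  obtain ⟨c₁, hc₁, hc₁w⟩ := hp.exists_lt_of_weightedSum_ge hε (γ := γ) hρ
  have hg0 := hp.apply_zero_pos
  have h1δ : 0 < 1 - δ := sub_pos.2 hδ.2
  have h1δ' : 0 < 1 + δ := by linarith [hδ.1]
  -- Levels v above c₁ keep the superlevel set inside the ball of radius ρ; the other bound ensures
  -- η / (1 - δ) ≤ ρ for the boundary deficit η = 1 - v / g(0).
  obtain ⟨c₂, hc₂, hc₂0⟩ : ∃ c₂, max c₁ (g 0 * (1 - (1 - δ) * ρ)) < c₂ ∧ c₂ < g 0 :=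
    exists_between (max_lt hc₁ (mul_lt_of_lt_one_right hg0 (by nlinarith [mul_pos h1δ hρ])))
  rw [max_lt_iff] at hc₂
  refine ⟨min 1 (superlevelVol g c₂), ⟨lt_min one_pos (hp.superlevelVol_pos hc₂0),
    min_le_left _ _⟩, ρ, hρ, fun s hs u hu heq => ?_⟩
  have hs2 := lt_min_iff.1 hs.2
  have hs01 : s ∈ Set.Icc (0 : ℝ) 1 := ⟨hs.1.le, hs2.1.le⟩
  have hvs := hp.superlevelVol_superlevelInv hl hs01
  have hvc : c₂ ≤ superlevelInv g s := hp.le_superlevelInv hs.1.le hs2.2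
  have hv0 : superlevelInv g s < g 0 := by
    by_contra h
    have := superlevelVol_antitone (g := g) (not_lt.1 h)
    rw [hvs, superlevelVol_apply_zero hp.one_le hp.lt_zero] at this
    exact absurd hs.1 (not_lt.2 this)
  rw [hp.region_levelScore hl hs01]
  rw [mass, hp.region_levelScore hl hs01] at heq
  set v := superlevelInv g s with hvdef
  set η := 1 - v / g 0 with hη
  have hη0 : 0 < η := sub_pos.2 ((div_lt_one hg0).2 hv0)
  have hηρ : η / (1 - δ) ≤ ρ := by
    rw [div_le_iff₀ h1δ]
    have : g 0 * (1 - (1 - δ) * ρ) ≤ v := hc₂.2.le.trans hvc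
    rw [mul_comm, ← le_div_iff₀ hg0] at this
    linarith
  have hmem : ∀ x, v ≤ g x ↔ 1 - g x / g 0 ≤ η := fun x => by
    rw [hη, sub_le_sub_iff_left, div_le_div_iff_of_pos_right hg0]
  have hη12 : η / (1 + δ) ≤ η / (1 - δ) :=
    div_le_div_of_nonneg_left hη0.le h1δ (by linarith [hδ.1])
  have hη1 : 0 < η / (1 + δ) := div_pos hη0 h1δ'
  have hη2 : 0 < η / (1 - δ) := div_pos hη0 h1δ
  -- the superlevel set lies between two balls of radii close to `η`
  have hinner : ball ε γ (η / (1 + δ)) ⊆ superlevel g v := fun x hx => by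
    refine ⟨hx.1, (hmem x).2 ?_⟩
    have h1 := (hp.deficit_mem hexp hx.1 (hH x (ball_mono (hη12.trans hηρ) hx))).2
    have h2 := hx.2
    rw [le_div_iff₀ h1δ'] at h2
    linarith
  have hDρ : superlevel g v ⊆ ball ε γ ρ := fun x hx =>
    ⟨hx.1, (hc₁w x hx.1 (hc₂.1.trans_le (hvc.trans hx.2))).le⟩
  have houter : superlevel g v ⊆ ball ε γ (η / (1 - δ)) := fun x hx => by
    refine ⟨hx.1, ?_⟩
    have h1 := (hp.deficit_mem hexp hx.1 (hH x (hDρ hx))).1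
    have h2 := (hmem x).1 hx.2
    rw [le_div_iff₀ h1δ]
    linarith
  -- hence its mean deficit is close to `c η`
  have hDm : MeasurableSet (superlevel g v) := by
    rw [hvdef, ← hp.region_levelScore hl hs01]
    exact (hp.uniformScore_levelScore hl).measurableSet_region s
  have hDd := hp.integral_deficit_mem hε hexp hDm (superlevel_subset_cube v)
    fun x hx => hH x (hDρ hx)
  have hBd := hp.integral_deficit_mem hε hexp (measurableSet_ball hε u) (ball_subset_cube u)
    fun x hx => hH x (ball_mono hu.2.le hx)
  have hV := ballVol_pos hp.one_le hε hγ hu.1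
  rw [hp.integral_deficit (superlevel_subset_cube v),
    show volume.real (superlevel g v) = s from hvs] at hDd
  rw [hp.integral_deficit (ball_subset_cube u), ← ballVol_eq,
    hW u ⟨hu.1, hu.2.le.trans (min_le_right _ _)⟩] at hBd
  set q := (∫ x in ball ε γ u, g x) / ballVol ε γ u with hq
  rw [div_eq_iff hs.1.ne'] at heq
  have hq' : ∫ x in ball ε γ u, g x = q * ballVol ε γ u := (div_mul_cancel₀ _ hV.ne').symm
  rw [heq] at hDd
  rw [hq'] at hBd
  -- The mean relative deficit, common to the superlevel set and the ball because their mean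
  -- densities agree.
  set κ := 1 - q / g 0 with hκ
  have eD : s - q * s / g 0 = κ * s := by rw [hκ]; ring
  have eB : ballVol ε γ u - q * ballVol ε γ u / g 0 = κ * ballVol ε γ u := by rw [hκ]; ring
  rw [eD] at hDd
  rw [eB] at hBd
  have hB1 : (1 - δ) * (c * u) ≤ κ := by
    refine le_of_mul_le_mul_right ?_ hV
    linarith [hBd.1]
  have hB2 : κ ≤ (1 + δ) * (c * u) := by
    refine le_of_mul_le_mul_right ?_ hV
    linarith [hBd.2]
  set R := (1 + δ) / (1 - δ) with hR
  have hR0 : 0 < R := div_pos h1δ' h1δ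
  have hR1 : 1 ≤ R := (one_le_div h1δ).2 (by linarith [hδ.1])
  -- Q is the ratio of the volumes of the outer and inner balls, whose radii have ratio R.
  set Q := R ^ ((K : ℝ) / ε) with hQ
  have hQ0 : 0 < Q := Real.rpow_pos_of_pos hR0 _
  have hηle : ∀ k, η / (1 - δ) ≤ γ k := fun k => (hηρ.trans (min_le_right _ _)).trans (hmγ k)
  have hVη : ballVol ε γ (η / (1 - δ)) = Q * ballVol ε γ (η / (1 + δ)) := by
    have e : η / (1 + δ) = R⁻¹ * (η / (1 - δ)) := by
      rw [hR]; field_simp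
    rw [e, ballVol_mul hε hγ (inv_pos.2 hR0) (inv_le_one_of_one_le₀ hR1) hηle,
      Real.inv_rpow hR0.le, mul_inv_cancel_left₀ hQ0.ne']
  have hV1 := ballVol_pos hp.one_le hε hγ hη1
  have hsl : ballVol ε γ (η / (1 + δ)) ≤ s := hvs ▸
    measureReal_mono hinner (volume_ne_top_of_subset_cube (superlevel_subset_cube v))
  have hsu : s ≤ Q * ballVol ε γ (η / (1 + δ)) := hVη ▸ hvs.symm.le.trans
    (measureReal_mono houter (volume_ne_top_of_subset_cube (ball_subset_cube _)))
  have hwnn : ∀ A : Set (Fin K → ℝ), MeasurableSet A → A ⊆ cube K →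
      0 ≤ᵐ[volume.restrict A] weightedSum ε γ := fun A hA hAc =>
    (ae_restrict_mem hA).mono fun x hx => weightedSum_nonneg hγ (hAc hx)
  have hWl : c * (η / (1 + δ)) * ballVol ε γ (η / (1 + δ)) ≤
      ∫ x in superlevel g v, weightedSum ε γ x := by
    rw [← hW _ ⟨hη1, (hη12.trans hηρ).trans (min_le_right _ _)⟩]
    exact setIntegral_mono_set (integrableOn_weightedSum hε (superlevel_subset_cube v))
      (hwnn _ hDm (superlevel_subset_cube v)) (LE.le.eventuallyLE hinner)
  have hWu : ∫ x in superlevel g v, weightedSum ε γ x ≤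
      c * (η / (1 - δ)) * (Q * ballVol ε γ (η / (1 + δ))) := by
    rw [← hVη, ← hW _ ⟨hη2, hηρ.trans (min_le_right _ _)⟩]
    exact setIntegral_mono_set (integrableOn_weightedSum hε (ball_subset_cube _))
      (hwnn _ (measurableSet_ball hε _) (ball_subset_cube _))
      (LE.le.eventuallyLE houter)
  have hκ0 : 0 ≤ κ := (by positivity [hc.1, hu.1] : (0 : ℝ) ≤ (1 - δ) * (c * u)).trans hB1
  have hD2 : κ ≤ (1 + δ) * (c * (η / (1 - δ)) * Q) := by
    refine le_of_mul_le_mul_right ?_ hV1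
    have h1 := mul_le_mul_of_nonneg_left hsl hκ0
    have h2 := mul_le_mul_of_nonneg_left hWu h1δ'.le
    linarith [hDd.2]
  have hD1 : (1 - δ) * (c * (η / (1 + δ))) ≤ κ * Q := by
    refine le_of_mul_le_mul_right ?_ hV1
    have h1 := mul_le_mul_of_nonneg_left hsu hκ0
    have h2 := mul_le_mul_of_nonneg_left hWl h1δ.le
    linarith [hDd.1]
  -- Comparing the two estimates of κ relates u to η. A factor Q comes from replacing the volume s
  -- by that of the inner or outer ball, a factor R from the relative error of the deficits.
  have hup : u ≤ Q * R * (η / (1 - δ)) := by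
    have h1 := hB1.trans hD2
    have e : (1 + δ) * (c * (η / (1 - δ)) * Q) = (1 - δ) * (c * (Q * R * (η / (1 - δ)))) := by
      rw [hR]; field_simp
    rw [e] at h1
    exact le_of_mul_le_mul_left (le_of_mul_le_mul_left h1 h1δ) hc.1
  have hlow : η / (1 + δ) ≤ Q * R * u := by
    have h1 := hD1.trans (mul_le_mul_of_nonneg_right hB2 hQ0.le)
    have e : (1 + δ) * (c * u) * Q = (1 - δ) * (c * (Q * R * u)) := by
      rw [hR]; field_simp
    rw [e] at h1
    exact le_of_mul_le_mul_left (le_of_mul_le_mul_left h1 h1δ) hc.1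
  have eη : η / (1 - δ) = R * (η / (1 + δ)) := by rw [hR]; field_simp
  -- The second factor R converts between the outer and inner radii.
  have hΛ : radiusRatio (K / ε) δ = Q * R ^ 2 := rfl
  rw [hΛ]
  refine ⟨(ball_mono ?_).trans hinner, houter.trans (ball_mono ?_)⟩
  · rw [div_le_iff₀ (by positivity)]
    rw [eη] at hup
    linarith
  · rw [eη]
    have := mul_le_mul_of_nonneg_left hlow hR0.le
    linarith

/-- The regions of the two scores with equal mean densities are asymptotically equivalent. -/
lemma IsPeaked.exists_volume_symmDiff_le (hp : IsPeaked g)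
    (hl : ContinuousOn (superlevelVol g) (Set.Ici 0)) (hε : 0 < ε) (hγ : ∀ k, 0 < γ k)
    (hexp : ∀ x ∈ cube K, g x = g 0 * (1 - weightedSum ε γ x + r x))
    (hr : r =o[𝓝[cube K] 0] (fun x => ‖x‖ ^ ε)) {e : ℝ} (he : 0 < e) :
    ∃ t₁ > 0, ∀ s ∈ Set.Ioo 0 t₁, ∀ t ∈ Set.Ioo 0 t₁,
      mass g (levelScore g) s / s = mass g (ballScore ε γ) t / t →
        0 < volume.real (region (levelScore g) s ∩ region (ballScore ε γ) t) ∧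
        s + t - 2 * volume.real (region (levelScore g) s ∩ region (ballScore ε γ) t) ≤
          e * volume.real (region (levelScore g) s ∩ region (ballScore ε γ) t) := by
  obtain ⟨m, hm, hmγ⟩ := exists_pos_le hp.one_le hγ
  have hp0 : 0 < (K : ℝ) / ε := div_pos (by exact_mod_cast hp.one_le) hε
  obtain ⟨δ, hδ, hΛ1, hΛe⟩ := exists_radiusRatio_lt hp0 he
  obtain ⟨t₁, ht₁, ρ, hρ, H⟩ :=
    hp.exists_ball_subset_superlevel_subset_ball hl hε hγ hexp hr hm hmγ hδ
  set Λ := radiusRatio (K / ε) δ with hΛ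
  have hΛ0 : 0 < Λ := one_pos.trans hΛ1
  -- The bound m / Λ keeps Λ u ≤ m ≤ γ_k, so that exact volume scaling is available up to the
  -- enlarged ball.
  have hρ' : 0 < min ρ (m / Λ) := lt_min hρ (div_pos hm hΛ0)
  refine ⟨min t₁ (ballVol ε γ (min ρ (m / Λ))), lt_min ht₁.1 (ballVol_pos hp.one_le hε hγ hρ'),
    fun s hs t ht heq => ?_⟩
  have hs2 := lt_min_iff.1 hs.2
  have ht2 := lt_min_iff.1 ht.2
  obtain ⟨u, hu0, hut, hu⟩ := exists_region_ballScore_eq hp.one_le hε hγ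
    ⟨ht.1.le, ht2.1.le.trans ht₁.2⟩
  have hult : u < min ρ (m / Λ) := ballVol_mono.reflect_lt (hut.trans_lt ht2.2)
  rw [lt_min_iff, lt_div_iff₀ hΛ0] at hult
  have hupos : 0 < u := hu0.lt_of_ne fun h => by
    rw [← h, ballVol_zero hp.one_le hε hγ] at hut
    exact ht.1.ne hut
  rw [mass.eq_1 g (ballScore ε γ), hu] at heq
  rw [hu]
  obtain ⟨h1, h2⟩ := H s ⟨hs.1, hs2.1⟩ u ⟨hupos, hult.1⟩ (by rw [heq, hut])
  set L := Λ ^ ((K : ℝ) / ε) with hL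
  have hL0 : 0 < L := Real.rpow_pos_of_pos hΛ0 _
  have hΛinv : Λ⁻¹ ≤ 1 := inv_le_one_of_one_le₀ hΛ1.le
  have hΛu : ∀ k, Λ * u ≤ γ k := fun k => by rw [mul_comm]; exact hult.2.le.trans (hmγ k)
  have huu : u ≤ Λ * u := le_mul_of_one_le_left hu0 hΛ1.le
  have hVup : ballVol ε γ (Λ * u) = L * t := by
    have h := ballVol_mul hε hγ (inv_pos.2 hΛ0) hΛinv hΛu
    rw [inv_mul_cancel_left₀ hΛ0.ne', hut, Real.inv_rpow hΛ0.le] at h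
    rw [h, mul_inv_cancel_left₀ hL0.ne']
  have hVlow : ballVol ε γ (u / Λ) = L⁻¹ * t := by
    rw [div_eq_inv_mul, ballVol_mul hε hγ (inv_pos.2 hΛ0) hΛinv fun k => huu.trans (hΛu k), hut,
      Real.inv_rpow hΛ0.le]
  have hsL : s ≤ L * t := by
    rw [← hVup, ← (hp.uniformScore_levelScore hl).volume_region s
      ⟨hs.1.le, hs2.1.le.trans ht₁.2⟩]
    exact measureReal_mono h2 (volume_ne_top_of_subset_cube (ball_subset_cube _))
  have hint : L⁻¹ * t ≤ volume.real (region (levelScore g) s ∩ ball ε γ u) := by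
    rw [← hVlow]
    exact measureReal_mono (Set.subset_inter h1 (ball_mono (div_le_self hu0 hΛ1.le)))
      (volume_ne_top_of_subset_cube (Set.inter_subset_left.trans (region_subset_cube _ _)))
  have hLt : 0 < L⁻¹ * t := mul_pos (inv_pos.2 hL0) ht.1
  refine ⟨hLt.trans_le hint, ?_⟩
  -- The sum s + t is at most (L + 1) t, and the intersection contains the ball of volume t / L;
  -- hence the factor L² + L, which is at most e + 2.
  have h3 : L * t + t = (L ^ 2 + L) * (L⁻¹ * t) := by field_simp
  have h4 : (L ^ 2 + L) * (L⁻¹ * t) ≤ (e + 2) * (L⁻¹ * t) :=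
    mul_le_mul_of_nonneg_right (by linarith) hLt.le
  have h5 := mul_le_mul_of_nonneg_left hint (by linarith : 0 ≤ e + 2)
  linarith

end Compare

/-! ### Relative differences, and crossings as α decreases to α_* -/

section Limits

variable {K : ℕ} {g : (Fin K → ℝ) → ℝ}

lemma IsPeaked.setIntegral_sub_mem (hp : IsPeaked g) {A B : Set (Fin K → ℝ)}
    (hA : MeasurableSet A) (hB : MeasurableSet B) (hAc : A ⊆ cube K) (hBA : B ⊆ A) :
    0 ≤ (∫ x in A, g x) - ∫ x in B, g x ∧
      (∫ x in A, g x) - ∫ x in B, g x ≤ g 0 * (volume.real A - volume.real B) := by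
  rw [← setIntegral_sdiff hB (integrableOn_of_subset_cube hp.cont hAc) hBA,
    ← measureReal_sdiff hBA hB (volume_ne_top_of_subset_cube hAc)]
  have hsub : A \ B ⊆ cube K := fun x hx => hAc hx.1
  exact ⟨setIntegral_nonneg (hA.diff hB) fun x hx => hp.nonneg x (hsub hx),
    setIntegral_le_mul_volume (integrableOn_of_subset_cube hp.cont hsub) (hA.diff hB) hsub
      fun x hx => le_apply_zero hp.lt_zero (hsub hx)⟩

lemma abs_limitRelDiff_false_le {A B : Set (Fin K → ℝ)} (hAc : A ⊆ cube K) (hBc : B ⊆ cube K)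
    {e : ℝ} (hpos : 0 < volume.real (A ∩ B))
    (h : volume.real A + volume.real B - 2 * volume.real (A ∩ B) ≤ e * volume.real (A ∩ B)) :
    |limitRelDiff g false A B| ≤ e := by
  have h1 : volume.real (A ∩ B) ≤ volume.real A :=
    measureReal_mono Set.inter_subset_left (volume_ne_top_of_subset_cube hAc)
  have h2 : volume.real (A ∩ B) ≤ volume.real B :=
    measureReal_mono Set.inter_subset_right (volume_ne_top_of_subset_cube hBc)
  simp only [limitRelDiff, condMass, Bool.false_eq_true, if_false]
  rw [abs_of_nonneg (div_nonneg (by linarith) hpos.le), div_le_iff₀ hpos]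
  exact h

lemma IsPeaked.condMass_true_pos (hp : IsPeaked g) {A : Set (Fin K → ℝ)} (hA : MeasurableSet A)
    (hAc : A ⊆ cube K) (hpos : 0 < volume.real A) (hg : ∀ x ∈ A, g 0 / 2 ≤ g x) :
    g 0 / 2 * volume.real A ≤ condMass g true A ∧ 0 < condMass g true A := by
  have h : g 0 / 2 * volume.real A ≤ condMass g true A :=
    mul_volume_le_setIntegral (integrableOn_of_subset_cube hp.cont hAc) hA hAc hg
  exact ⟨h, (mul_pos (half_pos hp.apply_zero_pos) hpos).trans_le h⟩

/-- The density is at most g(0) on the symmetric difference and at least g(0) / 2 on the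
intersection, whence the factor 2. -/
lemma IsPeaked.abs_limitRelDiff_true_le (hp : IsPeaked g) {A B : Set (Fin K → ℝ)}
    (hA : MeasurableSet A) (hB : MeasurableSet B) (hAc : A ⊆ cube K) (hBc : B ⊆ cube K)
    {e : ℝ} (he : 0 ≤ e) (hpos : 0 < volume.real (A ∩ B))
    (h : volume.real A + volume.real B - 2 * volume.real (A ∩ B) ≤ e * volume.real (A ∩ B))
    (hg : ∀ x ∈ A ∩ B, g 0 / 2 ≤ g x) : |limitRelDiff g true A B| ≤ 2 * e := by
  have h1 := hp.setIntegral_sub_mem hA (hA.inter hB) hAc Set.inter_subset_left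
  have h2 := hp.setIntegral_sub_mem hB (hA.inter hB) hBc Set.inter_subset_right
  obtain ⟨h3, h4⟩ := hp.condMass_true_pos (hA.inter hB) (Set.inter_subset_left.trans hAc) hpos hg
  have h5 := mul_le_mul_of_nonneg_left h hp.apply_zero_pos.le
  have h6 := mul_le_mul_of_nonneg_left h3 he
  simp only [limitRelDiff]
  rw [abs_of_nonneg (div_nonneg _ h4.le), div_le_iff₀ h4]
  · simp only [condMass, if_true] at h3 h4 h6 ⊢
    linarith [h1.2, h2.2]
  · simp only [condMass, if_true]
    linarith [h1.1, h2.1]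

/-- For the power ratio: q is the common mean density, s and t are the volumes of the two regions,
and v is that of their intersection. -/
lemma abs_div_sub_one_le {s t v e q : ℝ} (hq : 0 < q) (ht : 0 < t) (hvs : v ≤ s) (hvt : v ≤ t)
    (he : 0 ≤ e) (h : s + t - 2 * v ≤ e * v) : |q * s / (q * t) - 1| ≤ e := by
  have h1 : e * v ≤ e * t := mul_le_mul_of_nonneg_left hvt he
  rw [mul_div_mul_left _ _ hq.ne', div_sub_one ht.ne', abs_div, abs_of_pos ht, div_le_iff₀ ht,
    abs_le]
  constructor <;> linarith

lemma IsPeaked.one_lt_sum (hp : IsPeaked g) (hl : ContinuousOn (superlevelVol g) (Set.Ici 0))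
    {a : ℝ} (ha : a ∈ Set.Ioo (0 : ℝ) 1) : 1 < 1 - a + a * g 0 := by
  have := mul_lt_mul_of_pos_left (hp.one_lt_apply_zero hl) ha.1
  linarith

lemma IsPeaked.alphaStar_mem (hp : IsPeaked g)
    (hl : ContinuousOn (superlevelVol g) (Set.Ici 0)) {a : ℝ} (ha : a ∈ Set.Ioo (0 : ℝ) 1) :
    alphaStar a g ∈ Set.Ioo (0 : ℝ) 1 := by
  have h := hp.one_lt_sum hl ha
  rw [hp.alphaStar_eq]
  exact ⟨by positivity, (div_lt_one (by linarith)).2 h⟩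

/-- The range (α_*, 1) of α corresponds to levels strictly between the mean of g over the cube,
which is 1, and its peak value. -/
lemma IsPeaked.crossLevel_mem (hp : IsPeaked g)
    (hl : ContinuousOn (superlevelVol g) (Set.Ici 0)) {a α : ℝ} (ha : a ∈ Set.Ioo (0 : ℝ) 1)
    (hα : α ∈ Set.Ioo (alphaStar a g) 1) : crossLevel a α ∈ Set.Ioo 1 (g 0) := by
  have h0 := (hp.alphaStar_mem hl ha).1.trans hα.1
  have h1 : 1 < 1 / α := (one_lt_div h0).2 hα.2
  have h2 : 1 / α < 1 - a + a * g 0 := by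
    have := hα.1
    rw [hp.alphaStar_eq] at this
    rwa [div_lt_comm₀ (by linarith [hp.one_lt_sum hl ha]) h0] at this
  rw [crossLevel]
  refine ⟨(one_lt_div ha.1).2 (by linarith), (div_lt_iff₀ ha.1).2 (by linarith)⟩

lemma IsPeaked.tendsto_crossLevel (hp : IsPeaked g)
    (hl : ContinuousOn (superlevelVol g) (Set.Ici 0)) {a : ℝ} (ha : a ∈ Set.Ioo (0 : ℝ) 1) :
    Tendsto (crossLevel a) (𝓝[>] (alphaStar a g)) (𝓝 (g 0)) := by
  have hc : ContinuousAt (crossLevel a) (alphaStar a g) :=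
    ((continuousAt_const.div continuousAt_id (hp.alphaStar_mem hl ha).1.ne').sub
      continuousAt_const).div_const a
  have e : crossLevel a (alphaStar a g) = g 0 := by
    rw [crossLevel, hp.alphaStar_eq, one_div_one_div, add_sub_cancel_left,
      mul_div_cancel_left₀ _ ha.1.ne']
  have := hc.tendsto.mono_left (nhdsWithin_le_nhds (s := Set.Ioi (alphaStar a g)))
  rwa [e] at this

lemma IsPeaked.exists_isCrossing_levelScore (hp : IsPeaked g)
    (hl : ContinuousOn (superlevelVol g) (Set.Ici 0)) {a α : ℝ} (ha : a ∈ Set.Ioo (0 : ℝ) 1)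
    (hα : α ∈ Set.Ioo (alphaStar a g) 1) : ∃ t, IsCrossing a α (mass g (levelScore g)) t := by
  have hS := hp.uniformScore_levelScore hl
  have hq := hp.crossLevel_mem hl ha hα
  obtain ⟨t, ht, hbig⟩ := (hp.concentrates_levelScore hl).exists_lt_mass_div hS hp.cont hq.2
    (ρ := 1) ⟨one_pos, le_rfl⟩
  refine hS.exists_isCrossing hp.cont ha.1 (ρ := 1) ⟨one_pos, le_rfl⟩
    (hp.strictAntiOn_mass_levelScore hl) (fun s hs => ?_) hq.1 ht hbig
  rw [le_antisymm hs.2 hs.1, hp.mass_levelScore_one, div_one]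

/-- Monotonicity of the mean density up to ρ is enough: on [ρ, 1] its maximum is below g(0), and the
crossing level exceeds that maximum once α is near α_*. -/
lemma IsPeaked.eventually_exists_isCrossing (hp : IsPeaked g)
    (hl : ContinuousOn (superlevelVol g) (Set.Ici 0)) {S : (Fin K → ℝ) → ℝ} (hS : UniformScore S)
    (hconc : ConcentratesAtPeak g S) {ρ : ℝ} (hρ : ρ ∈ Set.Ioc (0 : ℝ) 1)
    (hanti : StrictAntiOn (fun t => mass g S t / t) (Set.Ioc 0 ρ)) {a : ℝ}
    (ha : a ∈ Set.Ioo (0 : ℝ) 1) :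
    ∀ᶠ α in 𝓝[>] (alphaStar a g), ∃ t, IsCrossing a α (mass g S) t := by
  have hc : ContinuousOn (fun t => mass g S t / t) (Set.Icc ρ 1) :=
    ((hS.continuousOn_mass hp.cont).mono (Set.Icc_subset_Icc hρ.1.le le_rfl)).div continuousOn_id
      fun t ht => (hρ.1.trans_le ht.1).ne'
  obtain ⟨t₁, ht₁, hmax⟩ := isCompact_Icc.exists_isMaxOn ⟨ρ, le_rfl, hρ.2⟩ hc
  have hlt := hp.mass_lt hS (t := t₁) ⟨hρ.1.trans_le ht₁.1, ht₁.2⟩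
  filter_upwards [(hp.tendsto_crossLevel hl ha).eventually_const_lt hlt,
    Ioo_mem_nhdsGT (hp.alphaStar_mem hl ha).2] with α h1 h2
  obtain ⟨t, ht, hbig⟩ :=
    hconc.exists_lt_mass_div hS hp.cont (hp.crossLevel_mem hl ha h2).2 hρ
  exact hS.exists_isCrossing hp.cont ha.1 hρ hanti (fun s hs => hmax hs) h1 ht hbig

/-- At any fixed t in (0, 1] the mean density is below g(0), hence eventually below the crossing
level, which pushes the crossing to the left of t. -/
lemma IsPeaked.eventually_crossing_lt (hp : IsPeaked g)
    (hl : ContinuousOn (superlevelVol g) (Set.Ici 0)) {S : (Fin K → ℝ) → ℝ} (hS : UniformScore S)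
    {a : ℝ} (ha : a ∈ Set.Ioo (0 : ℝ) 1) {f : ℝ → ℝ}
    (hf : ∀ᶠ α in 𝓝[>] (alphaStar a g), IsCrossing a α (mass g S) (f α)) {t₁ : ℝ} (ht₁ : 0 < t₁) :
    ∀ᶠ α in 𝓝[>] (alphaStar a g), f α < t₁ := by
  have hm : 0 < min t₁ 1 := lt_min ht₁ one_pos
  have hlt := hp.mass_lt hS (t := min t₁ 1) ⟨hm, min_le_right _ _⟩
  filter_upwards [(hp.tendsto_crossLevel hl ha).eventually_const_lt hlt, hf] with α h1 h2
  exact (h2.lt_of_div_lt ha.1 hm h1).trans_le (min_le_left _ _)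

end Limits

end MultiFDR

/-! ### Assembly of the limits -/

theorem proposition4p2 {K : ℕ} (hK : 1 ≤ K) (a : ℝ) (ha : a ∈ Set.Ioo (0 : ℝ) 1)
    -- the density of the p-values under false nulls
    (g : (Fin K → ℝ) → ℝ) (hg_nonneg : ∀ x ∈ cube K, 0 ≤ g x)
    (hg_int : ∫ x in cube K, g x = 1)
    (hg_cont : ContinuousOn g (cube K))
    (hg_max : ∀ x ∈ cube K, x ≠ 0 → g x < g 0)
    -- its lowest order expansion at the origin
    (ε : ℝ) (hε : 0 < ε) (γ : Fin K → ℝ) (hγ : ∀ k, 0 < γ k) (r : (Fin K → ℝ) → ℝ)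
    (hg_exp : ∀ x ∈ cube K, g x = g 0 * (1 - weightedSum ε γ x + r x))
    (hr : r =o[𝓝[cube K] 0] (fun x => ‖x‖ ^ ε))
    (hg_level : ContinuousOn (superlevelVol g) (Set.Ici 0))
    -- the random effects model
    {Ω : Type*} [MeasurableSpace Ω] (P : Measure Ω) [IsProbabilityMeasure P]
    (θ : ℕ → Ω → Bool) (ξ : ℕ → Ω → Fin K → ℝ) (hmodel : RandomEffectsModel P a g θ ξ) :
    ∃ Powo Pow rD rV : ℝ → ℝ,
      -- the limits that define the four functions exist
      (∀ α ∈ Set.Ioo (alphaStar a g) 1,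
        Tendsto (power P θ ξ (optRejected g α)) atTop (𝓝 (Powo α))) ∧
      (∀ᶠ α in 𝓝[>] (alphaStar a g),
        Tendsto (power P θ ξ (ballRejected ε γ α)) atTop (𝓝 (Pow α)) ∧
        TendstoInMeasure P
          (fun n ω => relDiff
            (optRejected g α n (fun i => ξ i ω) ∩ falseNulls n (fun i => θ i ω))
            (ballRejected ε γ α n (fun i => ξ i ω) ∩ falseNulls n (fun i => θ i ω)))
          atTop (fun _ => rD α) ∧
        TendstoInMeasure P
          (fun n ω => relDiff
            (optRejected g α n (fun i => ξ i ω) ∩ trueNulls n (fun i => θ i ω))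
            (ballRejected ε γ α n (fun i => ξ i ω) ∩ trueNulls n (fun i => θ i ω)))
          atTop (fun _ => rV α)) ∧
      -- the asymptotic equivalence of the two procedures
      Tendsto (fun α => Powo α / Pow α) (𝓝[>] (alphaStar a g)) (𝓝 1) ∧
      Tendsto rD (𝓝[>] (alphaStar a g)) (𝓝 0) ∧
      Tendsto rV (𝓝[>] (alphaStar a g)) (𝓝 0) := by

  have hp : IsPeaked g := ⟨hK, hg_nonneg, hg_int, hg_cont, hg_max⟩
  have hSo := hp.uniformScore_levelScore hg_level
  have hSb := uniformScore_ballScore hK hε hγ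
  have hα₀ := hp.alphaStar_mem hg_level ha
  have hIoo : ∀ᶠ α in 𝓝[>] (alphaStar a g), α ∈ Set.Ioo (alphaStar a g) 1 :=
    Ioo_mem_nhdsGT hα₀.2
  have hO : ∀ α ∈ Set.Ioo (alphaStar a g) 1, ∃ t, IsCrossing a α (mass g (levelScore g)) t :=
    fun α hα => hp.exists_isCrossing_levelScore hg_level ha hα
  choose! tO htO using hO
  have htO' : ∀ᶠ α in 𝓝[>] (alphaStar a g), IsCrossing a α (mass g (levelScore g)) (tO α) :=
    hIoo.mono htO
  obtain ⟨ρ, hρ, hanti⟩ := hp.exists_strictAntiOn_mass_ballScore hε hγ hg_exp hr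
  obtain ⟨tB, htB⟩ := (hp.eventually_exists_isCrossing hg_level hSb
    (hp.concentrates_ballScore hε hγ) hρ hanti ha).choice
  -- All three asymptotic claims rest on this comparison. It applies because both crossings tend to
  -- 0 and have the same mean density, `crossLevel a α`.
  have key : ∀ e > 0, ∀ᶠ α in 𝓝[>] (alphaStar a g),
      0 < volume.real (region (levelScore g) (tO α) ∩ region (ballScore ε γ) (tB α)) ∧
      tO α + tB α - 2 * volume.real (region (levelScore g) (tO α) ∩
        region (ballScore ε γ) (tB α)) ≤
          e * volume.real (region (levelScore g) (tO α) ∩ region (ballScore ε γ) (tB α)) ∧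
      ∀ x ∈ region (levelScore g) (tO α) ∩ region (ballScore ε γ) (tB α), g 0 / 2 ≤ g x := by
    intro e he
    obtain ⟨t₁, ht₁, H⟩ := hp.exists_volume_symmDiff_le hg_level hε hγ hg_exp hr he
    obtain ⟨t₂, ht₂, H2⟩ := hp.concentrates_levelScore hg_level (g 0 / 2)
      (half_lt_self hp.apply_zero_pos)
    filter_upwards [htO', htB, hp.eventually_crossing_lt hg_level hSo ha htO' (lt_min ht₁ ht₂),
      hp.eventually_crossing_lt hg_level hSb ha htB ht₁] with α h1 h2 h3 h4
    rw [lt_min_iff] at h3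
    obtain ⟨h5, h6⟩ := H (tO α) ⟨h1.mem.1, h3.1⟩ (tB α) ⟨h2.mem.1, h4⟩
      (((div_eq_iff_crossLevel_eq ha.1 h1.mem.1).1 h1.eq).trans
        ((div_eq_iff_crossLevel_eq ha.1 h2.mem.1).1 h2.eq).symm)
    exact ⟨h5, h6, fun x hx => H2 (tO α) ⟨h1.mem.1, h3.2⟩ x hx.1⟩
  have hvO : ∀ {α}, IsCrossing a α (mass g (levelScore g)) (tO α) →
      volume.real (region (levelScore g) (tO α)) = tO α :=
    fun h => hSo.volume_region _ ⟨h.mem.1.le, h.mem.2.le⟩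
  have hvB : ∀ {α}, IsCrossing a α (mass g (ballScore ε γ)) (tB α) →
      volume.real (region (ballScore ε γ) (tB α)) = tB α :=
    fun h => hSb.volume_region _ ⟨h.mem.1.le, h.mem.2.le⟩
  have hopt : ∀ {α}, 0 < α → optRejected g α =
      fun n x => bhRejected α n (fun i => levelScore g (x i)) := fun hα => by
    funext n x
    exact hp.optRejected_eq hg_level hα n x
  have hball : ∀ α, ballRejected ε γ α =
      fun n x => bhRejected α n (fun i => ballScore ε γ (x i)) := fun α => rfl
  have hfalse : falseNulls = nullsOf true := rfl
  have htrue : trueNulls = nullsOf false := rfl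
  rw [hfalse, htrue]
  have hrel : ∀ b : Bool, ∀ᶠ α in 𝓝[>] (alphaStar a g), TendstoInMeasure P
      (fun n ω => relDiff
        (optRejected g α n (fun i => ξ i ω) ∩ nullsOf b n (fun i => θ i ω))
        (ballRejected ε γ α n (fun i => ξ i ω) ∩ nullsOf b n (fun i => θ i ω)))
      atTop (fun _ => limitRelDiff g b (region (levelScore g) (tO α))
        (region (ballScore ε γ) (tB α))) := by
    intro b
    filter_upwards [htO', htB, hIoo, key 1 one_pos] with α h1 h2 h3 h4
    have hα : 0 < α := hα₀.1.trans h3.1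
    rw [hopt hα, hball]
    refine hmodel.tendstoInMeasure_relDiff ha hg_cont hg_nonneg hα hSo h1 hSb h2 b ?_
    cases b
    · exact h4.1.ne'
    · exact (hp.condMass_true_pos ((hSo.measurableSet_region _).inter (hSb.measurableSet_region _))
        (Set.inter_subset_left.trans (region_subset_cube _ _)) h4.1 h4.2.2).2.ne'
  refine ⟨fun α => mass g (levelScore g) (tO α), fun α => mass g (ballScore ε γ) (tB α),
    fun α => limitRelDiff g true (region (levelScore g) (tO α)) (region (ballScore ε γ) (tB α)),
    fun α => limitRelDiff g false (region (levelScore g) (tO α)) (region (ballScore ε γ) (tB α)),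
    fun α hα => ?_, ?_, ?_, ?_, ?_⟩
  · rw [hopt (hα₀.1.trans hα.1)]
    exact hmodel.tendsto_power ha hg_cont hg_nonneg hg_int (hα₀.1.trans hα.1) hSo (htO α hα)
  · filter_upwards [htB, hIoo, hrel true, hrel false] with α h1 h2 h3 h4
    refine ⟨?_, h3, h4⟩
    rw [hball]
    exact hmodel.tendsto_power ha hg_cont hg_nonneg hg_int (hα₀.1.trans h2.1) hSb h1
  · refine Metric.tendsto_nhds.2 fun e he => ?_
    filter_upwards [htO', htB, hIoo, key (e / 2) (half_pos he)] with α h1 h2 h3 h4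
    have hO := (div_eq_iff_crossLevel_eq ha.1 h1.mem.1).1 h1.eq
    have hB := (div_eq_iff_crossLevel_eq ha.1 h2.mem.1).1 h2.eq
    rw [div_eq_iff h1.mem.1.ne'] at hO
    rw [div_eq_iff h2.mem.1.ne'] at hB
    -- Both limiting powers are the common mean density times the volume of the region.
    rw [hO, hB, Real.dist_eq]
    refine (abs_div_sub_one_le (one_pos.trans (hp.crossLevel_mem hg_level ha h3).1) h2.mem.1
      ?_ ?_ (half_pos he).le h4.2.1).trans_lt (half_lt_self he)
    · exact (measureReal_mono Set.inter_subset_left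
        (volume_ne_top_of_subset_cube (region_subset_cube _ _))).trans_eq (hvO h1)
    · exact (measureReal_mono Set.inter_subset_right
        (volume_ne_top_of_subset_cube (region_subset_cube _ _))).trans_eq (hvB h2)
  · refine Metric.tendsto_nhds.2 fun e he => ?_
    -- Passing to the law under false nulls doubles the bound to e / 2, which is strictly below e.
    filter_upwards [htO', htB, key (e / 4) (by positivity)] with α h1 h2 h4
    rw [Real.dist_eq, sub_zero]
    refine (hp.abs_limitRelDiff_true_le (hSo.measurableSet_region _) (hSb.measurableSet_region _)
      (region_subset_cube _ _) (region_subset_cube _ _) (e := e / 4) (by positivity) h4.1 ?_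
      h4.2.2).trans_lt (by linarith)
    rw [hvO h1, hvB h2]
    exact h4.2.1
  · refine Metric.tendsto_nhds.2 fun e he => ?_
    filter_upwards [htO', htB, key (e / 2) (half_pos he)] with α h1 h2 h4
    rw [Real.dist_eq, sub_zero]
    refine (abs_limitRelDiff_false_le (region_subset_cube _ _) (region_subset_cube _ _) h4.1
      ?_).trans_lt (half_lt_self he)
    rw [hvO h1, hvB h2]
    exact h4.2.1
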